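/- Let $R$ be a Banach ring, that is, a commutative unital ring with a complete norm such that $|ab|\le C|a||b|$ for some constant $C>0$. Let $\mathrm{Ban}_R$ be the category of Banach $R$-modules (complete normed $R$-modules $M$ with $\|am\|\le C_M|a|\,\|m\|$ for some constant $C_M>0$) and bounded $R$-linear maps, with the completed projective tensor product $\widehat\otimes_R$. Extend $\widehat\otimes_R$ to the category $\mathrm{Ind}(\mathrm{Ban}_R)$ of ind-objects by $(\text{“}\operatorname{colim}_i\text{”}\,V_i)\,\widehat\otimes_R\,(\text{“}\operatorname{colim}_j\text{”}\,W_j)=\text{“}\operatorname{colim}_{(i,j)}\text{”}\,V_i\widehat\otimes_R W_j$. Call an object $V$ of $\mathrm{Ind}(\mathrm{Ban}_R)$ metrizable if the category whose objects are the objects $X$ of $\mathrm{Ban}_R$ equipped with a morphism $X\to V$, and whose morphisms are the commuting triangles, is $\aleph_1$-filtered (every countable diagram in it has a cocone). Then $\mathrm{Ind}(\mathrm{Ban}_R)$ has countable products, and for every object $V$ of $\mathrm{Ind}(\mathrm{Ban}_R)$: 1. $V$ is metrizable if and only if the functor $V\widehat\otimes_R(-)$ commutes with countable products, i.e. for every countable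 family $(W_k)_{k\in K}$ of objects of $\mathrm{Ind}(\mathrm{Ban}_R)$ the natural morphism $V\widehat\otimes_R\prod_{k\in K}W_k\to\prod_{k\in K}(V\widehat\otimes_R W_k)$ is an isomorphism. 2. If merely the natural morphism $V\widehat\otimes_R\prod_{\mathbb Z}R\to\prod_{\mathbb Z}V$, whose $n$-th component is $V\widehat\otimes_R\prod_{\mathbb Z}R\to V\widehat\otimes_R R\cong V$ (induced by the $n$-th projection), is an isomorphism, then $V$ is metrizable. -/

import Mathlib

open CategoryTheory CategoryTheory.Limits
open scoped TensorProduct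

universe u

/-- A Banach ring: a commutative ring with a complete norm such that `‖a * b‖ ≤ C * ‖a‖ * ‖b‖`
for some constant `C > 0`. -/
class BanachRing (R : Type u) extends CommRing R, NormedAddCommGroup R, CompleteSpace R where
  exists_norm_mul_le : ∃ C : ℝ, 0 < C ∧ ∀ a b : R, ‖a * b‖ ≤ C * ‖a‖ * ‖b‖

/-- A Banach module over a Banach ring `R`. -/
structure BanMod (R : Type u) [BanachRing R] where
  carrier : Type u
  [normedAddCommGroup : NormedAddCommGroup carrier]
  [module : Module R carrier]
  [completeSpace : CompleteSpace carrier]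
  exists_norm_smul_le : ∃ C : ℝ, 0 < C ∧ ∀ (a : R) (m : carrier), ‖a • m‖ ≤ C * ‖a‖ * ‖m‖

namespace BanMod

variable {R : Type u} [BanachRing R]

instance : CoeSort (BanMod R) (Type u) := ⟨carrier⟩

attribute [instance] normedAddCommGroup module completeSpace

/-- A bounded `R`-linear map. -/
@[ext]
structure Hom (M N : BanMod R) where
  toLinearMap : M →ₗ[R] N
  exists_norm_le : ∃ C : ℝ, 0 < C ∧ ∀ m : M, ‖toLinearMap m‖ ≤ C * ‖m‖

/-- The category `Ban_R` of Banach `R`-modules and bounded `R`-linear maps. -/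
instance : Category (BanMod R) where
  Hom := Hom
  id M := ⟨LinearMap.id, 1, one_pos, fun m => by simp⟩
  comp f g := ⟨g.toLinearMap ∘ₗ f.toLinearMap, by
    obtain ⟨C, hC, hf⟩ := f.exists_norm_le
    obtain ⟨D, hD, hg⟩ := g.exists_norm_le
    refine ⟨D * C, mul_pos hD hC, fun m => (hg _).trans ?_⟩
    rw [mul_assoc]
    exact mul_le_mul_of_nonneg_left (hf m) hD.le⟩

@[ext]
lemma hom_ext {M N : BanMod R} {f g : M ⟶ N}
    (h : ∀ m, f.toLinearMap m = g.toLinearMap m) : f = g :=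
  Hom.ext (LinearMap.ext h)

@[simp] lemma id_toLinearMap (M : BanMod R) : (𝟙 M : M ⟶ M).toLinearMap = LinearMap.id := rfl

@[simp] lemma comp_toLinearMap {M N P : BanMod R} (f : M ⟶ N) (g : N ⟶ P) :
    (f ≫ g).toLinearMap = g.toLinearMap ∘ₗ f.toLinearMap := rfl

variable (R) in
/-- `R` as a Banach module over itself. -/
def self : BanMod R where
  carrier := R
  exists_norm_smul_le := BanachRing.exists_norm_mul_le

/-! ### The completed projective tensor product -/

/-- The algebraic tensor product, to be equipped with the projective semi-norm. -/
def AlgTensor (M N : BanMod R) : Type u := M ⊗[R] N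

variable {M N M' N' : BanMod R}

noncomputable instance : AddCommGroup (AlgTensor M N) := inferInstanceAs (AddCommGroup (M ⊗[R] N))
noncomputable instance : Module R (AlgTensor M N) := inferInstanceAs (Module R (M ⊗[R] N))

/-- The elementary tensor `m ⊗ n`, as a bilinear map. -/
noncomputable def AlgTensor.mk (M N : BanMod R) : M →ₗ[R] N →ₗ[R] AlgTensor M N :=
  TensorProduct.mk R M N

@[elab_as_elim]
lemma AlgTensor.induction {p : AlgTensor M N → Prop} (x : AlgTensor M N) (zero : p 0)
    (mk : ∀ m n, p (AlgTensor.mk M N m n)) (add : ∀ x y, p x → p y → p (x + y)) : p x :=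
  TensorProduct.induction_on x zero mk add

/-- The linear map on the algebraic tensor product attached to a bilinear map. -/
noncomputable def AlgTensor.lift {P : Type*} [AddCommGroup P] [Module R P]
    (f : M →ₗ[R] N →ₗ[R] P) : AlgTensor M N →ₗ[R] P :=
  TensorProduct.lift f

lemma AlgTensor.lift_mk {P : Type*} [AddCommGroup P] [Module R P]
    (f : M →ₗ[R] N →ₗ[R] P) (m : M) (n : N) :
    AlgTensor.lift f (AlgTensor.mk M N m n) = f m n :=
  TensorProduct.lift.tmul m n

/-- The element `m₁ ⊗ n₁ + ⋯ + m_k ⊗ n_k` represented by a finite list of pairs. -/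
noncomputable def listTensor (l : List (M × N)) : AlgTensor M N :=
  (l.map fun p => AlgTensor.mk M N p.1 p.2).sum

/-- The sum `‖m₁‖ * ‖n₁‖ + ⋯ + ‖m_k‖ * ‖n_k‖` attached to a finite list of pairs. -/
noncomputable def listNorm (l : List (M × N)) : ℝ := (l.map fun p => ‖p.1‖ * ‖p.2‖).sum

/-- The projective semi-norm: the infimum of the sums `∑ ‖mᵢ‖ * ‖nᵢ‖` over all finite
representations `x = ∑ mᵢ ⊗ nᵢ`. -/
noncomputable def projNorm (x : AlgTensor M N) : ℝ :=
  sInf {s | ∃ l : List (M × N), listTensor l = x ∧ listNorm l = s}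

lemma listNorm_nonneg (l : List (M × N)) : 0 ≤ listNorm l :=
  List.sum_nonneg (by simp only [List.mem_map]; rintro _ ⟨p, -, rfl⟩; positivity)

lemma listTensor_nil : listTensor ([] : List (M × N)) = 0 := rfl

lemma listNorm_nil : listNorm ([] : List (M × N)) = 0 := rfl

lemma listTensor_cons (p : M × N) (l : List (M × N)) :
    listTensor (p :: l) = AlgTensor.mk M N p.1 p.2 + listTensor l := by simp [listTensor]

lemma listNorm_cons (p : M × N) (l : List (M × N)) :
    listNorm (p :: l) = ‖p.1‖ * ‖p.2‖ + listNorm l := by simp [listNorm]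

lemma listTensor_append (l l' : List (M × N)) :
    listTensor (l ++ l') = listTensor l + listTensor l' := by simp [listTensor]

lemma listNorm_append (l l' : List (M × N)) :
    listNorm (l ++ l') = listNorm l + listNorm l' := by simp [listNorm]

lemma exists_listTensor (x : AlgTensor M N) : ∃ l : List (M × N), listTensor l = x := by
  induction x using AlgTensor.induction with
  | zero => exact ⟨[], rfl⟩
  | mk m n => exact ⟨[(m, n)], by simp [listTensor]⟩
  | add x y hx hy =>
    obtain ⟨l, rfl⟩ := hx
    obtain ⟨l', rfl⟩ := hy
    exact ⟨l ++ l', listTensor_append l l'⟩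

lemma projNorm_le (l : List (M × N)) : projNorm (listTensor l) ≤ listNorm l :=
  csInf_le ⟨0, by rintro _ ⟨l, -, rfl⟩; exact listNorm_nonneg l⟩ ⟨l, rfl, rfl⟩

lemma le_projNorm {x : AlgTensor M N} {c : ℝ}
    (h : ∀ l : List (M × N), listTensor l = x → c ≤ listNorm l) : c ≤ projNorm x :=
  le_csInf (let ⟨l, hl⟩ := exists_listTensor x; ⟨_, l, hl, rfl⟩)
    (by rintro _ ⟨l, hl, rfl⟩; exact h l hl)

lemma projNorm_mk_le (m : M) (n : N) : projNorm (AlgTensor.mk M N m n) ≤ ‖m‖ * ‖n‖ := by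
  simpa [listTensor, listNorm] using projNorm_le [(m, n)]

lemma norm_le_projNorm {G : Type*} [SeminormedAddCommGroup G] (f : AlgTensor M N →+ G) {C : ℝ}
    (hC : 0 < C) (hf : ∀ (m : M) (n : N), ‖f (AlgTensor.mk M N m n)‖ ≤ C * ‖m‖ * ‖n‖)
    (x : AlgTensor M N) : ‖f x‖ ≤ C * projNorm x := by
  rw [← div_le_iff₀' hC]
  refine le_projNorm fun l hl => ?_
  rw [div_le_iff₀' hC]
  subst hl
  induction l with
  | nil => simp [listTensor_nil, listNorm_nil]
  | cons p l ih =>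
    rw [listTensor_cons, listNorm_cons, map_add]
    refine (norm_add_le _ _).trans ?_
    have := hf p.1 p.2
    nlinarith

/-- The projective semi-norm as a group semi-norm. -/
noncomputable def projSeminorm (M N : BanMod R) : AddGroupSeminorm (AlgTensor M N) where
  toFun := projNorm
  map_zero' := le_antisymm (projNorm_le (M := M) (N := N) [])
    (le_projNorm fun l _ => listNorm_nonneg l)
  add_le' x y := by
    rw [← sub_le_iff_le_add]
    refine le_projNorm fun l hl => ?_
    rw [sub_le_comm]
    refine le_projNorm fun l' hl' => ?_
    rw [sub_le_iff_le_add, ← hl, ← hl', ← listTensor_append, add_comm, ← listNorm_append]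
    exact projNorm_le _
  neg' x := by
    have key : ∀ y : AlgTensor M N, projNorm (-y) ≤ projNorm y := fun y => by
      refine le_projNorm fun l hl => ?_
      have h1 : ∀ l : List (M × N),
          listTensor (l.map fun p => (-p.1, p.2)) = -listTensor l := fun l => by
        induction l with
        | nil => simp [listTensor_nil]
        | cons p l ih => rw [List.map_cons, listTensor_cons, listTensor_cons, ih]; simp; abel
      have h2 : listNorm (l.map fun p => (-p.1, p.2)) = listNorm l := by
        simp [listNorm, Function.comp_def]
      rw [← hl, ← h1, ← h2]
      exact projNorm_le _
    exact le_antisymm (key x) (by simpa using key (-x))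

noncomputable instance : SeminormedAddCommGroup (AlgTensor M N) :=
  (projSeminorm M N).toSeminormedAddCommGroup

lemma norm_smul_le_projNorm (M N : BanMod R) :
    ∃ C : ℝ, 0 < C ∧ ∀ (a : R) (x : AlgTensor M N), ‖a • x‖ ≤ C * ‖a‖ * ‖x‖ := by
  obtain ⟨C, hC, h⟩ := M.exists_norm_smul_le
  refine ⟨C, hC, fun a x => ?_⟩
  have key : ∀ x : AlgTensor M N, ∀ ε > 0, ‖a • x‖ ≤ (C * ‖a‖ + ε) * ‖x‖ := fun x ε hε => by
    refine norm_le_projNorm (DistribSMul.toAddMonoidHom _ a) (by positivity) (fun m n => ?_) x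
    have := projNorm_mk_le (a • m) n
    rw [map_smul] at this
    refine this.trans (mul_le_mul_of_nonneg_right ((h a m).trans ?_) (norm_nonneg _))
    exact mul_le_mul_of_nonneg_right (by linarith) (norm_nonneg _)
  refine le_of_forall_pos_le_add fun ε hε => ?_
  have h' := key x (ε / (‖x‖ + 1)) (by positivity)
  have : ε / (‖x‖ + 1) * ‖x‖ ≤ ε := by
    rw [div_mul_eq_mul_div, div_le_iff₀ (by positivity)]
    nlinarith [norm_nonneg x]
  nlinarith

instance : UniformContinuousConstSMul R (AlgTensor M N) := by
  obtain ⟨C, hC, h⟩ := norm_smul_le_projNorm M N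
  refine ⟨fun a => ?_⟩
  exact (AddMonoidHomClass.lipschitz_of_bound (DistribSMul.toAddMonoidHom (AlgTensor M N) a)
    (C * ‖a‖) (fun x => h a x)).uniformContinuous

/-- The completed projective tensor product `M ⊗̂_R N`: the separated completion of `M ⊗_R N` for
the projective semi-norm. -/
noncomputable def tensor (M N : BanMod R) : BanMod R where
  carrier := UniformSpace.Completion (AlgTensor M N)
  exists_norm_smul_le := by
    obtain ⟨C, hC, h⟩ := norm_smul_le_projNorm M N
    refine ⟨C, hC, fun a x => ?_⟩
    have hc : Continuous fun x : UniformSpace.Completion (AlgTensor M N) => a • x :=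
      UniformSpace.Completion.continuous_map
    induction x using UniformSpace.Completion.induction_on with
    | hp => exact isClosed_le hc.norm (continuous_const.mul continuous_norm)
    | ih x =>
      rw [← UniformSpace.Completion.coe_smul, UniformSpace.Completion.norm_coe,
        UniformSpace.Completion.norm_coe]
      exact h a x

/-- The elementary tensor `m ⊗ n` of the completed tensor product, as a bilinear map. -/
noncomputable def tensorMk (M N : BanMod R) : M →ₗ[R] N →ₗ[R] tensor M N :=
  (AlgTensor.mk M N).compr₂
    { toFun := fun x => (x : UniformSpace.Completion (AlgTensor M N))
      map_add' := UniformSpace.Completion.coe_add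
      map_smul' := UniformSpace.Completion.coe_smul }

lemma norm_tensorMk_le (m : M) (n : N) : ‖tensorMk M N m n‖ ≤ ‖m‖ * ‖n‖ :=
  (UniformSpace.Completion.norm_coe (AlgTensor.mk M N m n)).trans_le (projNorm_mk_le m n)

lemma Hom.continuous (f : M ⟶ N) : Continuous f.toLinearMap := by
  obtain ⟨C, -, hf⟩ := f.exists_norm_le
  exact AddMonoidHomClass.continuous_of_bound f.toLinearMap C hf

lemma tensor_hom_ext {P : BanMod R} {f g : tensor M N ⟶ P}
    (h : ∀ m n, f.toLinearMap (tensorMk M N m n) = g.toLinearMap (tensorMk M N m n)) :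
    f = g := by
  ext x
  induction x using UniformSpace.Completion.induction_on with
  | hp => exact isClosed_eq (Hom.continuous f) (Hom.continuous g)
  | ih x =>
    induction x using AlgTensor.induction with
    | zero =>
      rw [UniformSpace.Completion.coe_zero]
      exact (map_zero f.toLinearMap).trans (map_zero g.toLinearMap).symm
    | mk m n => exact h m n
    | add x y hx hy =>
      rw [UniformSpace.Completion.coe_add]
      refine (map_add f.toLinearMap _ _).trans (Eq.trans ?_ (map_add g.toLinearMap _ _).symm)
      rw [hx, hy]

/-- A bilinear map that is bounded on elementary tensors, as a bounded additive map. -/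
noncomputable def boundedLift {P : BanMod R} (f : M →ₗ[R] N →ₗ[R] P)
    (hf : ∃ C : ℝ, 0 < C ∧ ∀ m n, ‖f m n‖ ≤ C * ‖m‖ * ‖n‖) :
    NormedAddGroupHom (AlgTensor M N) P where
  toFun := AlgTensor.lift f
  map_add' := map_add _
  bound' := by
    obtain ⟨C, hC, h⟩ := hf
    exact ⟨C, norm_le_projNorm (AlgTensor.lift f).toAddMonoidHom hC
      (fun m n => (congrArg norm (AlgTensor.lift_mk f m n)).trans_le (h m n))⟩

/-- A bounded bilinear map extends to the completed tensor product. -/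
noncomputable def tensorLift {P : BanMod R} (f : M →ₗ[R] N →ₗ[R] P)
    (hf : ∃ C : ℝ, 0 < C ∧ ∀ m n, ‖f m n‖ ≤ C * ‖m‖ * ‖n‖) : tensor M N ⟶ P where
  toLinearMap :=
    { toFun := (boundedLift f hf).extension
      map_add' := map_add _
      map_smul' := fun a x => by
        have hP : Continuous fun y : P => a • y := by
          obtain ⟨C, -, h⟩ := P.exists_norm_smul_le
          exact AddMonoidHomClass.continuous_of_bound (DistribSMul.toAddMonoidHom P a)
            (C * ‖a‖) (h a)
        induction x using UniformSpace.Completion.induction_on with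
        | hp =>
          exact isClosed_eq ((boundedLift f hf).extension.continuous.comp
            UniformSpace.Completion.continuous_map) (hP.comp (boundedLift f hf).extension.continuous)
        | ih x =>
          refine (congrArg _ (UniformSpace.Completion.coe_smul a x).symm).trans ?_
          refine (NormedAddGroupHom.extension_coe _ _).trans ?_
          refine (map_smul (AlgTensor.lift f) a x).trans ?_
          exact congrArg (a • ·) (NormedAddGroupHom.extension_coe (boundedLift f hf) x).symm }
  exists_norm_le := by
    obtain ⟨C, hC, h⟩ := (boundedLift f hf).extension.bound
    exact ⟨C, hC, h⟩

lemma tensorLift_mk {P : BanMod R} (f : M →ₗ[R] N →ₗ[R] P)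
    (hf : ∃ C : ℝ, 0 < C ∧ ∀ m n, ‖f m n‖ ≤ C * ‖m‖ * ‖n‖) (m : M) (n : N) :
    (tensorLift f hf).toLinearMap (tensorMk M N m n) = f m n :=
  (NormedAddGroupHom.extension_coe (boundedLift f hf) _).trans (AlgTensor.lift_mk f m n)

/-- The map `f ⊗̂ g`. -/
noncomputable def tensorMap (f : M ⟶ M') (g : N ⟶ N') : tensor M N ⟶ tensor M' N' :=
  tensorLift ((tensorMk M' N').compl₁₂ f.toLinearMap g.toLinearMap) (by
    obtain ⟨C, hC, hf⟩ := f.exists_norm_le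
    obtain ⟨D, hD, hg⟩ := g.exists_norm_le
    refine ⟨C * D, mul_pos hC hD, fun m n => (norm_tensorMk_le _ _).trans ?_⟩
    calc ‖f.toLinearMap m‖ * ‖g.toLinearMap n‖ ≤ (C * ‖m‖) * (D * ‖n‖) :=
          mul_le_mul (hf m) (hg n) (norm_nonneg _) (by positivity)
      _ = C * D * ‖m‖ * ‖n‖ := by ring)

lemma tensorMap_mk (f : M ⟶ M') (g : N ⟶ N') (m : M) (n : N) :
    (tensorMap f g).toLinearMap (tensorMk M N m n) =
      tensorMk M' N' (f.toLinearMap m) (g.toLinearMap n) :=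
  tensorLift_mk _ _ _ _

variable (R) in
/-- The completed projective tensor product as a bifunctor `(M, N) ↦ M ⊗̂_R N`. -/
noncomputable def tensorFunctor : BanMod R ⥤ BanMod R ⥤ BanMod R where
  obj M :=
    { obj := fun N => tensor M N
      map := fun g => tensorMap (𝟙 M) g
      map_id := fun N => tensor_hom_ext fun m n => by simp [tensorMap_mk]
      map_comp := fun f g => tensor_hom_ext fun m n => by simp [tensorMap_mk] }
  map f :=
    { app := fun N => tensorMap f (𝟙 N)
      naturality := fun N N' g => tensor_hom_ext fun m n => by simp [tensorMap_mk] }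
  map_id M := by ext N : 2; exact tensor_hom_ext fun m n => by simp [tensorMap_mk]
  map_comp f g := by ext N : 2; exact tensor_hom_ext fun m n => by simp [tensorMap_mk]

/-- The unit isomorphism `M ⊗̂_R R ≅ M`, `m ⊗ r ↦ r • m`. -/
noncomputable def tensorUnit (M : BanMod R) : tensor M (self R) ≅ M where
  hom := tensorLift (N := self R) (LinearMap.lsmul R M).flip (by
    obtain ⟨C, hC, h⟩ := M.exists_norm_smul_le
    exact ⟨C, hC, fun m (r : R) => (h r m).trans_eq (mul_right_comm C ‖r‖ ‖m‖)⟩)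
  inv :=
    { toLinearMap := (tensorMk M (self R)).flip (1 : R)
      exists_norm_le := ⟨‖(1 : R)‖ + 1, by positivity, fun m => by
        refine (norm_tensorMk_le (N := self R) m (1 : R)).trans ?_
        have : ‖m‖ * ‖(1 : R)‖ ≤ (‖(1 : R)‖ + 1) * ‖m‖ := by nlinarith [norm_nonneg m]
        exact this⟩ }
  hom_inv_id := tensor_hom_ext fun m (r : R) => by
    refine (congrArg (fun z => tensorMk M (self R) z (1 : R))
      (tensorLift_mk (N := self R) (LinearMap.lsmul R M).flip _ m r)).trans ?_
    have h1 := (tensorMk M (self R)).map_smul₂ r m (1 : R)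
    have h2 := (tensorMk M (self R) m).map_smul r (1 : R)
    refine h1.trans (h2.symm.trans ?_)
    exact congrArg (tensorMk M (self R) m) (mul_one r)
  inv_hom_id := by
    ext m
    simp only [comp_toLinearMap, LinearMap.comp_apply]
    exact (tensorLift_mk (N := self R) _ _ m (1 : R)).trans (one_smul R m)

variable (R) in
/-- The isomorphism `M ⊗̂_R R ≅ M` is natural in `M`. -/
noncomputable def tensorUnitIso : (tensorFunctor R).flip.obj (self R) ≅ 𝟭 (BanMod R) :=
  NatIso.ofComponents tensorUnit fun {M N} f => tensor_hom_ext fun m (r : R) => by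
    refine (congrArg (tensorUnit N).hom.toLinearMap
      (tensorMap_mk f (𝟙 (self R)) m r)).trans ?_
    refine (tensorLift_mk (N := self R) _ _ (f.toLinearMap m) r).trans ?_
    refine (f.toLinearMap.map_smul r m).symm.trans ?_
    exact congrArg f.toLinearMap
      (tensorLift_mk (N := self R) (LinearMap.lsmul R M).flip _ m r).symm

end BanMod

namespace CategoryTheory.Ind

universe v w

variable {C : Type w} [Category.{v} C]

/-- An ind-object `V` of `C` is metrizable if the category of objects `X` of `C` equipped with a
morphism `X ⟶ V`, with commutative triangles as morphisms, is `ℵ₁`-filtered. -/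
def IsMetrizable (V : Ind C) : Prop :=
  haveI : Fact (Cardinal.aleph 1 : Cardinal.{0}).IsRegular := ⟨Cardinal.isRegular_aleph_one⟩
  IsCardinalFiltered (CostructuredArrow Ind.yoneda V) (Cardinal.aleph 1 : Cardinal.{0})

instance hasPointwiseLeftKanExtension_yoneda {H : Type*} [Category* H]
    [HasFilteredColimitsOfSize.{v, v} H] (F : C ⥤ H) :
    (Ind.yoneda (C := C)).HasPointwiseLeftKanExtension F := fun X => by
  let e : CostructuredArrow Ind.yoneda X ≌ CostructuredArrow yoneda ((Ind.inclusion C).obj X) :=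
    (CostructuredArrow.post Ind.yoneda (Ind.inclusion C) X).asEquivalence.trans
      (CostructuredArrow.mapNatIso Ind.yonedaCompInclusion)
  have : HasColimit (X.presentation.toCostructuredArrow ⋙ e.inverse ⋙
      CostructuredArrow.proj Ind.yoneda X ⋙ F) :=
    HasColimitsOfShape.has_colimit _
  have : HasColimit (e.symm.functor ⋙ CostructuredArrow.proj Ind.yoneda X ⋙ F) :=
    Functor.Final.hasColimit_of_comp X.presentation.toCostructuredArrow
  exact hasColimit_of_equivalence_comp e.symm

instance hasFilteredColimits_functor {A H : Type*} [Category* A] [Category* H]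
    [HasFilteredColimitsOfSize.{v, v} H] : HasFilteredColimitsOfSize.{v, v} (A ⥤ H) where
  HasColimitsOfShape _ _ _ := inferInstance

/-- The extension of a functor to ind-objects in its target and source:
`F̃(“colim” Wⱼ) = “colim” F(Wⱼ)`, the left Kan extension along `C ⥤ Ind C`. -/
noncomputable def extendFunctor : (C ⥤ C) ⥤ (Ind C ⥤ Ind C) :=
  (Functor.whiskeringRight _ _ _).obj Ind.yoneda ⋙ Ind.yoneda.lan

/-- The comparison `F(X) ⟶ F̃(X)` for `X` in `C`. -/
noncomputable def extendFunctorUnit (F : C ⥤ C) :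
    F ⋙ Ind.yoneda ⟶ Ind.yoneda ⋙ extendFunctor.obj F :=
  Ind.yoneda.lanUnit.app (F ⋙ Ind.yoneda)

lemma extendFunctorUnit_naturality {F G : C ⥤ C} (t : F ⟶ G) (X : C) :
    Ind.yoneda.map (t.app X) ≫ (extendFunctorUnit G).app X =
      (extendFunctorUnit F).app X ≫ (extendFunctor.map t).app (Ind.yoneda.obj X) :=
  congr_app (Ind.yoneda.lanUnit.naturality (Functor.whiskerRight t Ind.yoneda)) X

instance isIso_extendFunctorUnit (F : C ⥤ C) (X : C) : IsIso ((extendFunctorUnit F).app X) :=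
  (Ind.yoneda.isPointwiseLeftKanExtensionLeftKanExtensionUnit (F ⋙ Ind.yoneda)
    (Ind.yoneda.obj X)).isIso_hom_app

/-- The isomorphism `F̃(X) ≅ F(X)` for `X` in `C`. -/
noncomputable def extendFunctorObjIso (F : C ⥤ C) (X : C) :
    (extendFunctor.obj F).obj (Ind.yoneda.obj X) ≅ Ind.yoneda.obj (F.obj X) :=
  (asIso ((extendFunctorUnit F).app X)).symm

lemma extendFunctorObjIso_naturality {F G : C ⥤ C} (t : F ⟶ G) (X : C) :
    (extendFunctor.map t).app (Ind.yoneda.obj X) ≫ (extendFunctorObjIso G X).hom =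
      (extendFunctorObjIso F X).hom ≫ Ind.yoneda.map (t.app X) := by
  rw [← Iso.inv_comp_eq, ← Category.assoc, ← Iso.eq_comp_inv]
  exact (extendFunctorUnit_naturality t X).symm

/-- The extension of a bifunctor `T` on `C` to ind-objects,
`T̃(“colim” Vᵢ, “colim” Wⱼ) = “colim” T(Vᵢ, Wⱼ)`, obtained by left Kan extension along
`C ⥤ Ind C` in each of the two variables. -/
noncomputable def extendBifunctor (T : C ⥤ C ⥤ C) : Ind C ⥤ Ind C ⥤ Ind C :=
  Ind.yoneda.lan.obj (T ⋙ extendFunctor)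

/-- The colimit cocone with point `T̃(V, -)`, indexed by the objects `X ⟶ V` over `V`, whose
components are the morphisms `T̃(X, -) ⟶ T̃(V, -)`. -/
noncomputable def bifunctorCocone (T : C ⥤ C ⥤ C) (V : Ind C) :
    Cocone (CostructuredArrow.proj Ind.yoneda V ⋙ T ⋙ extendFunctor) :=
  (Functor.LeftExtension.mk (extendBifunctor T)
    (Ind.yoneda.lanUnit.app (T ⋙ extendFunctor))).coconeAt V

noncomputable def isColimitBifunctorCocone (T : C ⥤ C ⥤ C) (V : Ind C) :
    IsColimit (bifunctorCocone T V) :=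
  Ind.yoneda.isPointwiseLeftKanExtensionLeftKanExtensionUnit (T ⋙ extendFunctor) V

noncomputable def isColimitBifunctorCoconeEval (T : C ⥤ C ⥤ C) (V W : Ind C) :
    IsColimit (((evaluation _ _).obj W).mapCocone (bifunctorCocone T V)) :=
  have (W' : Ind C) : HasColimit ((CostructuredArrow.proj Ind.yoneda V ⋙
      T ⋙ extendFunctor).flip.obj W') :=
    hasPointwiseLeftKanExtension_yoneda ((T ⋙ extendFunctor).flip.obj W') V
  isColimitOfPreserves _ (isColimitBifunctorCocone T V)

variable {T : C ⥤ C ⥤ C} {U : C}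

/-- A natural isomorphism `T(X, U) ≅ X` for `X` in `C` induces a morphism `T̃(V, U) ⟶ V` for every
ind-object `V`: on the component of an object `X ⟶ V` over `V` it is `T(X, U) ≅ X ⟶ V`. -/
noncomputable def extendUnit (ρ : T.flip.obj U ≅ 𝟭 C) (V : Ind C) :
    ((extendBifunctor T).obj V).obj (Ind.yoneda.obj U) ⟶ V :=
  (isColimitBifunctorCoconeEval T V (Ind.yoneda.obj U)).desc
    { pt := V
      ι :=
        { app := fun g => (extendFunctorObjIso (T.obj g.left) U).hom ≫
            Ind.yoneda.map (ρ.hom.app g.left) ≫ g.hom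
          naturality := fun g g' f => by
            have h1 := extendFunctorObjIso_naturality (T.map f.left) U
            have h2 : (T.map f.left).app U ≫ ρ.hom.app g'.left = ρ.hom.app g.left ≫ f.left :=
              ρ.hom.naturality f.left
            have h3 : Ind.yoneda.map f.left ≫ g'.hom = g.hom := CostructuredArrow.w f
            refine Eq.trans ?_ (Category.comp_id _).symm
            refine (Category.assoc _ _ _).symm.trans ((congrArg (· ≫ _) h1).trans ?_)
            rw [Category.assoc, ← Ind.yoneda.map_comp_assoc, h2, Ind.yoneda.map_comp_assoc, h3]
            rfl } }

end CategoryTheory.Ind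

/-- The completed projective tensor product on `Ind(Ban_R)`. -/
noncomputable def indTensor (R : Type u) [BanachRing R] :
    Ind (BanMod R) ⥤ Ind (BanMod R) ⥤ Ind (BanMod R) :=
  Ind.extendBifunctor (BanMod.tensorFunctor R)

/-- The unit `R` of `⊗̂_R`, as an object of `Ind(Ban_R)`. -/
noncomputable def indUnit (R : Type u) [BanachRing R] : Ind (BanMod R) :=
  Ind.yoneda.obj (BanMod.self R)

/-- The canonical identification `V ⊗̂_R R ⟶ V`. -/
noncomputable def indTensorUnit {R : Type u} [BanachRing R] (V : Ind (BanMod R)) :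
    ((indTensor R).obj V).obj (indUnit R) ⟶ V :=
  Ind.extendUnit (BanMod.tensorUnitIso R) V

/-- The natural morphism `V ⊗̂_R ∏_ℤ R ⟶ ∏_ℤ V`, whose `n`-th component is
`V ⊗̂_R ∏_ℤ R ⟶ V ⊗̂_R R ≅ V`, the first map being induced by the `n`-th projection. -/
noncomputable def tensorProdToProd {R : Type u} [BanachRing R]
    [HasCountableProducts (Ind (BanMod R))] (V : Ind (BanMod R)) :
    ((indTensor R).obj V).obj (∏ᶜ fun _ : ℤ => indUnit R) ⟶ ∏ᶜ fun _ : ℤ => V :=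
  Pi.lift fun n => ((indTensor R).obj V).map (Pi.π (fun _ : ℤ => indUnit R) n) ≫ indTensorUnit V

/-!
Write `y : Ban_R ⥤ Ind(Ban_R)` for the embedding. Every assertion about ind-objects below is
checked on morphisms out of `y X`, for `X` a Banach module (`Ind.isIso_of_bijective`). A morphism
`y X ⟶ V ⊗̂ W` is a morphism `X ⟶ A ⊗̂ B` for some `y A ⟶ V` and `y B ⟶ W`, and two of them agree
when they agree after enlarging `A` over `V` and `B` over `W`
(`Ind.exists_comp_toExtendBifunctor_eq₂`, `Ind.exists_comp_map_eq_of_toExtendBifunctor`).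

The analytic input is the weighted `ℓ¹`-sum `BanMod.weightedSum B n` of countably many Banach
modules `B k`, with norm `∑ₖ 2^(-n k) * ‖b k‖`. Any countable family of morphisms `Z ⟶ B k` lifts
to it once the weights decay fast enough (`BanMod.exists_weightedSum_lift`), so the presheaf `∏ₖ y
(B k)` is the filtered colimit of the weighted sums over all weights; hence it is an ind-object,
and `Ind(Ban_R)` has countable products. Moreover `A ⊗̂ -` commutes with `ℓ¹`-sums, in the sense
that morphisms `Z ⟶ A ⊗̂ weightedSum B n` are determined by their components in the `A ⊗̂ B k`,
and any countable family of components is attained for suitable weights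
(`BanMod.tensor_weightedSum_hom_ext`, `BanMod.exists_tensor_weightedSum_lift`).

If `V` is metrizable, countably many elements of the `V ⊗̂ W k` come from elements of `A ⊗̂ B k`
with one common `A` over `V`, and lift to `A ⊗̂ weightedSum B n`; if two elements of `V ⊗̂ ∏ W k`
have the same components, the countably many enlargements of `A` witnessing this can be merged
into one. So `V ⊗̂ -` commutes with countable products.

Conversely, suppose that `V ⊗̂ ∏_ℤ R ⟶ ∏_ℤ V` is an isomorphism. Given `a n : y (A n) ⟶ V`, the
morphism `y S ⟶ ∏_ℤ V` from the weighted sum `S` of the `A n`, with components `S ⟶ A n ⟶ V`,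
lifts to some `S ⟶ D ⊗̂ B` with `y D ⟶ V`; projecting `B` to the factors `R` shows that all `a n`
factor through `D`. Given morphisms `f n, f' : X ⟶ Y` that agree in `V`, the elements `(f n)` and
`(f')` of `Y ⊗̂ ∏_ℤ R` agree in `V ⊗̂ ∏_ℤ R` by injectivity, hence already in `D ⊗̂ B` for some
`D` over `V` under `Y`, and `D` equalizes all of them. These two properties say that `V` is
metrizable. Finally, `V ⊗̂ R ⟶ V` is an isomorphism, so preservation of countable products implies
the hypothesis of this converse.
-/

/-! ### Morphisms from an object of `C` to an ind-object -/

namespace CategoryTheory.Ind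

universe v w

variable {C : Type w} [Category.{v} C]

/-- Evaluating an ind-object, viewed as a presheaf, at `X` amounts to taking morphisms out of
`X`. -/
noncomputable def inclusionCompEvaluationIso (X : C) :
    coyoneda.obj (Opposite.op (Ind.yoneda.obj X)) ≅
      Ind.inclusion C ⋙ (evaluation _ _).obj (Opposite.op X) :=
  NatIso.ofComponents
    (fun V => (Ind.inclusion.fullyFaithful.homEquiv.trans
      (((Ind.yonedaCompInclusion.app X).homCongr (Iso.refl _)).trans yonedaEquiv)).toIso)
    (fun {V W} f => by
      ext x
      simp [yonedaEquiv_apply, Functor.FullyFaithful.homEquiv])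

/-- The objects of `C` detect isomorphisms of ind-objects. -/
lemma isIso_of_bijective {V W : Ind C} (f : V ⟶ W)
    (h : ∀ X : C, Function.Bijective fun x : Ind.yoneda.obj X ⟶ V => x ≫ f) : IsIso f := by
  have : ∀ X, IsIso (((Ind.inclusion C).map f).app X) := fun X => by
    exact (NatIso.isIso_map_iff (inclusionCompEvaluationIso X.unop) f).1
      ((isIso_iff_bijective _).2 (h X.unop))
  have : IsIso ((Ind.inclusion C).map f) := NatIso.isIso_of_isIso_app _
  exact isIso_of_reflects_iso f (Ind.inclusion C)

instance (X : C) : PreservesFilteredColimitsOfSize.{v, v}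
    (coyoneda.obj (Opposite.op (Ind.yoneda.obj X))) where
  preserves_filtered_colimits _ _ _ :=
    preservesColimitsOfShape_of_natIso (inclusionCompEvaluationIso X).symm

instance isFiltered_costructuredArrow (V : Ind C) : IsFiltered (CostructuredArrow Ind.yoneda V) :=
  RepresentablyCoflat.filtered V

instance finallySmall_costructuredArrow (V : Ind C) :
    FinallySmall.{v} (CostructuredArrow Ind.yoneda V) := by
  let e : CostructuredArrow Ind.yoneda V ≌ CostructuredArrow yoneda ((Ind.inclusion C).obj V) :=
    (CostructuredArrow.post Ind.yoneda (Ind.inclusion C) V).asEquivalence.trans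
      (CostructuredArrow.mapNatIso Ind.yonedaCompInclusion)
  have := (Ind.isIndObject_inclusion_obj V).finallySmall
  exact finallySmall_of_final_of_finallySmall e.inverse

section Elements

variable {V : Ind C} {F : CostructuredArrow Ind.yoneda V ⥤ Ind C} {c : Cocone F}

instance (X : C) : PreservesColimitsOfShape (CostructuredArrow Ind.yoneda V)
    (coyoneda.obj (Opposite.op (Ind.yoneda.obj X))) :=
  FinallySmall.preservesColimitsOfShape_of_isFiltered.{v} _ _

/-- The objects of `C` are finitely presentable in `Ind C`; this and the next lemma spell it out for
colimits indexed by the (large, but finally small) category of objects over an ind-object. -/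
lemma exists_comp_ι_eq (hc : IsColimit c) {X : C} (x : Ind.yoneda.obj X ⟶ c.pt) :
    ∃ (j : CostructuredArrow Ind.yoneda V) (x' : Ind.yoneda.obj X ⟶ F.obj j), x' ≫ c.ι.app j = x :=
  Types.jointly_surjective_of_isColimit
    (isColimitOfPreserves (coyoneda.obj (Opposite.op (Ind.yoneda.obj X))) hc) x

lemma exists_comp_map_eq (hc : IsColimit c) {X : C} {j : CostructuredArrow Ind.yoneda V}
    {x x' : Ind.yoneda.obj X ⟶ F.obj j} (h : x ≫ c.ι.app j = x' ≫ c.ι.app j) :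
    ∃ (j' : CostructuredArrow Ind.yoneda V) (f : j ⟶ j'), x ≫ F.map f = x' ≫ F.map f :=
  (Types.FilteredColimit.isColimit_eq_iff'
    (isColimitOfPreserves (coyoneda.obj (Opposite.op (Ind.yoneda.obj X))) hc) x x').1 h

end Elements

end CategoryTheory.Ind

/-! ### Elements of the extension of a bifunctor to ind-objects -/

namespace CategoryTheory.Ind

universe v w

variable {C : Type w} [Category.{v} C]

/-- Two morphisms of `C` that become equal in the ind-object `V` become equal at a later stage
of `V`. -/
lemma exists_comp_eq_of_comp_eq {V : Ind C} {X A : C} (f f' : X ⟶ A) (a : Ind.yoneda.obj A ⟶ V)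
    (h : Ind.yoneda.map f ≫ a = Ind.yoneda.map f' ≫ a) :
    ∃ (A' : C) (a' : Ind.yoneda.obj A' ⟶ V) (g : A ⟶ A'),
      Ind.yoneda.map g ≫ a' = a ∧ f ≫ g = f' ≫ g := by
  let φ : CostructuredArrow.mk (Ind.yoneda.map f ≫ a) ⟶ CostructuredArrow.mk a :=
    CostructuredArrow.homMk f
  let φ' : CostructuredArrow.mk (Ind.yoneda.map f ≫ a) ⟶ CostructuredArrow.mk a :=
    CostructuredArrow.homMk f' h.symm
  refine ⟨(IsFiltered.coeq φ φ').left, (IsFiltered.coeq φ φ').hom,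
    (IsFiltered.coeqHom φ φ').left, CostructuredArrow.w (IsFiltered.coeqHom φ φ'), ?_⟩
  exact congrArg (·.left) (IsFiltered.coeq_condition φ φ')

/-- Two objects of `C` over `V` map to a third one. -/
lemma exists_common {V : Ind C} {A B : C} (a : Ind.yoneda.obj A ⟶ V) (b : Ind.yoneda.obj B ⟶ V) :
    ∃ (D : C) (d : Ind.yoneda.obj D ⟶ V) (f : A ⟶ D) (g : B ⟶ D),
      Ind.yoneda.map f ≫ d = a ∧ Ind.yoneda.map g ≫ d = b :=
  let j := CostructuredArrow.mk a
  let k := CostructuredArrow.mk b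
  ⟨(IsFiltered.max j k).left, (IsFiltered.max j k).hom, (IsFiltered.leftToMax j k).left,
    (IsFiltered.rightToMax j k).left, CostructuredArrow.w (IsFiltered.leftToMax j k),
    CostructuredArrow.w (IsFiltered.rightToMax j k)⟩

section ExtendFunctor

/-- The morphism `F(B) ⟶ F̃(W)` attached to an object `b : B ⟶ W` over `W`. -/
noncomputable def toExtendFunctor (F : C ⥤ C) {W : Ind C} {B : C} (b : Ind.yoneda.obj B ⟶ W) :
    Ind.yoneda.obj (F.obj B) ⟶ (extendFunctor.obj F).obj W :=
  (extendFunctorUnit F).app B ≫ (extendFunctor.obj F).map b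

lemma toExtendFunctor_comp_map (F : C ⥤ C) {W W' : Ind C} {B : C} (b : Ind.yoneda.obj B ⟶ W)
    (w : W ⟶ W') :
    toExtendFunctor F b ≫ (extendFunctor.obj F).map w = toExtendFunctor F (b ≫ w) := by
  simp [toExtendFunctor]

lemma map_comp_toExtendFunctor (F : C ⥤ C) {W : Ind C} {B B' : C} (g : B ⟶ B')
    (b : Ind.yoneda.obj B' ⟶ W) :
    Ind.yoneda.map (F.map g) ≫ toExtendFunctor F b =
      toExtendFunctor F (Ind.yoneda.map g ≫ b) := by
  have := (extendFunctorUnit F).naturality_assoc g ((extendFunctor.obj F).map b)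
  simpa [toExtendFunctor] using this

lemma toExtendFunctor_naturality {F G : C ⥤ C} (t : F ⟶ G) {W : Ind C} {B : C}
    (b : Ind.yoneda.obj B ⟶ W) :
    toExtendFunctor F b ≫ (extendFunctor.map t).app W =
      Ind.yoneda.map (t.app B) ≫ toExtendFunctor G b := by
  have := extendFunctorUnit_naturality t B
  simp only [toExtendFunctor, Category.assoc]
  rw [reassoc_of% this, (extendFunctor.map t).naturality]

/-- `F̃(W)` is the colimit of the objects `F(B)`, for `B` over `W`. -/
noncomputable def isColimitExtendFunctor (F : C ⥤ C) (W : Ind C) :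
    IsColimit ((Functor.LeftExtension.mk (extendFunctor.obj F) (extendFunctorUnit F)).coconeAt W) :=
  Ind.yoneda.isPointwiseLeftKanExtensionLeftKanExtensionUnit (F ⋙ Ind.yoneda) W

lemma exists_comp_toExtendFunctor_eq (F : C ⥤ C) {W : Ind C} {X : C}
    (x : Ind.yoneda.obj X ⟶ (extendFunctor.obj F).obj W) :
    ∃ (B : C) (b : Ind.yoneda.obj B ⟶ W) (ξ : X ⟶ F.obj B),
      Ind.yoneda.map ξ ≫ toExtendFunctor F b = x := by
  obtain ⟨j, x', h⟩ := exists_comp_ι_eq (isColimitExtendFunctor F W) x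
  obtain ⟨ξ, hξ⟩ := Ind.yoneda.map_surjective
    (show Ind.yoneda.obj X ⟶ Ind.yoneda.obj (F.obj j.left) from x')
  exact ⟨j.left, j.hom, ξ, (congrArg (· ≫ toExtendFunctor F j.hom) hξ).trans h⟩

lemma exists_comp_map_eq_of_toExtendFunctor (F : C ⥤ C) {W : Ind C} {X B : C}
    (b : Ind.yoneda.obj B ⟶ W) {ξ ξ' : X ⟶ F.obj B}
    (h : Ind.yoneda.map ξ ≫ toExtendFunctor F b = Ind.yoneda.map ξ' ≫ toExtendFunctor F b) :
    ∃ (B' : C) (b' : Ind.yoneda.obj B' ⟶ W) (g : B ⟶ B'),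
      Ind.yoneda.map g ≫ b' = b ∧ ξ ≫ F.map g = ξ' ≫ F.map g := by
  obtain ⟨j, f, h⟩ := exists_comp_map_eq (isColimitExtendFunctor F W)
    (j := CostructuredArrow.mk b) h
  refine ⟨j.left, j.hom, f.left, CostructuredArrow.w f, Ind.yoneda.map_injective ?_⟩
  rw [Functor.map_comp, Functor.map_comp]
  exact h

end ExtendFunctor

section ExtendBifunctor

variable (T : C ⥤ C ⥤ C) {V W : Ind C}

/-- The component `T̃(A, -) ⟶ T̃(V, -)` of the colimit cocone at an object `a : A ⟶ V` over `V`. -/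
noncomputable def extendBifunctorι {A : C} (a : Ind.yoneda.obj A ⟶ V) :
    extendFunctor.obj (T.obj A) ⟶ (extendBifunctor T).obj V :=
  (bifunctorCocone T V).ι.app (CostructuredArrow.mk a)

lemma map_comp_extendBifunctorι {A A' : C} (f : A ⟶ A') (a : Ind.yoneda.obj A' ⟶ V) :
    extendFunctor.map (T.map f) ≫ extendBifunctorι T a =
      extendBifunctorι T (Ind.yoneda.map f ≫ a) :=
  (bifunctorCocone T V).w
    (CostructuredArrow.homMk f : CostructuredArrow.mk (Ind.yoneda.map f ≫ a) ⟶ .mk a)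

lemma exists_comp_extendBifunctorι_eq {X : C}
    (x : Ind.yoneda.obj X ⟶ ((extendBifunctor T).obj V).obj W) :
    ∃ (A : C) (a : Ind.yoneda.obj A ⟶ V)
      (x' : Ind.yoneda.obj X ⟶ (extendFunctor.obj (T.obj A)).obj W),
      x' ≫ (extendBifunctorι T a).app W = x :=
  let ⟨j, x', h⟩ := exists_comp_ι_eq (isColimitBifunctorCoconeEval T V W) x
  ⟨j.left, j.hom, x', h⟩

lemma exists_comp_map_eq_of_extendBifunctorι {X A : C} (a : Ind.yoneda.obj A ⟶ V)
    {x x' : Ind.yoneda.obj X ⟶ (extendFunctor.obj (T.obj A)).obj W}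
    (h : x ≫ (extendBifunctorι T a).app W = x' ≫ (extendBifunctorι T a).app W) :
    ∃ (A' : C) (a' : Ind.yoneda.obj A' ⟶ V) (f : A ⟶ A'), Ind.yoneda.map f ≫ a' = a ∧
      x ≫ (extendFunctor.map (T.map f)).app W = x' ≫ (extendFunctor.map (T.map f)).app W :=
  let ⟨j, f, h⟩ := exists_comp_map_eq (isColimitBifunctorCoconeEval T V W)
    (j := CostructuredArrow.mk a) h
  ⟨j.left, j.hom, f.left, CostructuredArrow.w f, h⟩

/-- The morphism `T(A, B) ⟶ T̃(V, W)` attached to objects `a : A ⟶ V` over `V` and `b : B ⟶ W`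
over `W`. -/
noncomputable def toExtendBifunctor {A B : C} (a : Ind.yoneda.obj A ⟶ V)
    (b : Ind.yoneda.obj B ⟶ W) :
    Ind.yoneda.obj ((T.obj A).obj B) ⟶ ((extendBifunctor T).obj V).obj W :=
  toExtendFunctor (T.obj A) b ≫ (extendBifunctorι T a).app W

lemma toExtendBifunctor_comp_map {W' : Ind C} {A B : C} (a : Ind.yoneda.obj A ⟶ V)
    (b : Ind.yoneda.obj B ⟶ W) (w : W ⟶ W') :
    toExtendBifunctor T a b ≫ ((extendBifunctor T).obj V).map w =
      toExtendBifunctor T a (b ≫ w) := by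
  rw [toExtendBifunctor, toExtendBifunctor, ← toExtendFunctor_comp_map, Category.assoc,
    Category.assoc, (extendBifunctorι T a).naturality]

lemma map_app_comp_toExtendBifunctor {A A' B : C} (f : A ⟶ A') (a : Ind.yoneda.obj A' ⟶ V)
    (b : Ind.yoneda.obj B ⟶ W) :
    Ind.yoneda.map ((T.map f).app B) ≫ toExtendBifunctor T a b =
      toExtendBifunctor T (Ind.yoneda.map f ≫ a) b := by
  rw [toExtendBifunctor, toExtendBifunctor, ← map_comp_extendBifunctorι, ← Category.assoc,
    ← toExtendFunctor_naturality, NatTrans.comp_app, Category.assoc]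

lemma map_comp_toExtendBifunctor {A B B' : C} (g : B ⟶ B') (a : Ind.yoneda.obj A ⟶ V)
    (b : Ind.yoneda.obj B' ⟶ W) :
    Ind.yoneda.map ((T.obj A).map g) ≫ toExtendBifunctor T a b =
      toExtendBifunctor T a (Ind.yoneda.map g ≫ b) := by
  rw [toExtendBifunctor, toExtendBifunctor, ← map_comp_toExtendFunctor, Category.assoc]

/-- Every morphism `X ⟶ T̃(V, W)` factors through some `T(A, B)`. -/
lemma exists_comp_toExtendBifunctor_eq {X : C}
    (x : Ind.yoneda.obj X ⟶ ((extendBifunctor T).obj V).obj W) :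
    ∃ (A B : C) (a : Ind.yoneda.obj A ⟶ V) (b : Ind.yoneda.obj B ⟶ W)
      (ξ : X ⟶ (T.obj A).obj B), Ind.yoneda.map ξ ≫ toExtendBifunctor T a b = x := by
  obtain ⟨A, a, x', rfl⟩ := exists_comp_extendBifunctorι_eq T x
  obtain ⟨B, b, ξ, rfl⟩ := exists_comp_toExtendFunctor_eq (T.obj A) x'
  exact ⟨A, B, a, b, ξ, (Category.assoc _ _ _).symm⟩

/-- Two morphisms `X ⟶ T(A, B)` that become equal in `T̃(V, W)` become equal at a later stage
of `V` and `W`. -/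
lemma exists_comp_map_eq_of_toExtendBifunctor {X A B : C}
    (a : Ind.yoneda.obj A ⟶ V) (b : Ind.yoneda.obj B ⟶ W) {ξ ξ' : X ⟶ (T.obj A).obj B}
    (h : Ind.yoneda.map ξ ≫ toExtendBifunctor T a b =
      Ind.yoneda.map ξ' ≫ toExtendBifunctor T a b) :
    ∃ (A' B' : C) (a' : Ind.yoneda.obj A' ⟶ V) (b' : Ind.yoneda.obj B' ⟶ W) (f : A ⟶ A')
      (g : B ⟶ B'), Ind.yoneda.map f ≫ a' = a ∧ Ind.yoneda.map g ≫ b' = b ∧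
        ξ ≫ (T.map f).app B ≫ (T.obj A').map g = ξ' ≫ (T.map f).app B ≫ (T.obj A').map g := by
  rw [toExtendBifunctor, ← Category.assoc, ← Category.assoc] at h
  obtain ⟨A', a', f, hf, h⟩ := exists_comp_map_eq_of_extendBifunctorι T a h
  rw [Category.assoc, Category.assoc, toExtendFunctor_naturality, ← Category.assoc,
    ← Category.assoc, ← Functor.map_comp, ← Functor.map_comp] at h
  obtain ⟨B', b', g, hg, h⟩ := exists_comp_map_eq_of_toExtendFunctor _ b h
  exact ⟨A', B', a', b', f, g, hf, hg, by simpa using h⟩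

/-- Two morphisms `X ⟶ T̃(V, W)` factor through the same `T(A, B)`. -/
lemma exists_comp_toExtendBifunctor_eq₂ {X X' : C}
    (x : Ind.yoneda.obj X ⟶ ((extendBifunctor T).obj V).obj W)
    (x' : Ind.yoneda.obj X' ⟶ ((extendBifunctor T).obj V).obj W) :
    ∃ (A B : C) (a : Ind.yoneda.obj A ⟶ V) (b : Ind.yoneda.obj B ⟶ W)
      (ξ : X ⟶ (T.obj A).obj B) (ξ' : X' ⟶ (T.obj A).obj B),
      Ind.yoneda.map ξ ≫ toExtendBifunctor T a b = x ∧
      Ind.yoneda.map ξ' ≫ toExtendBifunctor T a b = x' := by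
  obtain ⟨A₁, B₁, a₁, b₁, ξ₁, rfl⟩ := exists_comp_toExtendBifunctor_eq T x
  obtain ⟨A₂, B₂, a₂, b₂, ξ₂, rfl⟩ := exists_comp_toExtendBifunctor_eq T x'
  obtain ⟨A, a, f₁, f₂, rfl, rfl⟩ := exists_common a₁ a₂
  obtain ⟨B, b, g₁, g₂, rfl, rfl⟩ := exists_common b₁ b₂
  refine ⟨A, B, a, b, ξ₁ ≫ (T.map f₁).app B₁ ≫ (T.obj A).map g₁,
    ξ₂ ≫ (T.map f₂).app B₂ ≫ (T.obj A).map g₂, ?_, ?_⟩ <;>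
  simp [map_comp_toExtendBifunctor, map_app_comp_toExtendBifunctor]

variable {T} {U : C}

lemma toExtendFunctor_comp_extendFunctorObjIso (F : C ⥤ C) {B : C} (g : B ⟶ U) :
    toExtendFunctor F (Ind.yoneda.map g) ≫ (extendFunctorObjIso F U).hom =
      Ind.yoneda.map (F.map g) := by
  rw [← Category.comp_id (Ind.yoneda.map g), ← map_comp_toExtendFunctor, Category.assoc]
  simp [toExtendFunctor, extendFunctorObjIso]

lemma toExtendBifunctor_comp_extendUnit (ρ : T.flip.obj U ≅ 𝟭 C) {A B : C}
    (a : Ind.yoneda.obj A ⟶ V) (g : B ⟶ U) :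
    toExtendBifunctor T a (Ind.yoneda.map g) ≫ extendUnit ρ V =
      Ind.yoneda.map ((T.obj A).map g ≫ ρ.hom.app A) ≫ a := by
  have h : (extendBifunctorι T a).app (Ind.yoneda.obj U) ≫ extendUnit ρ V =
      (extendFunctorObjIso (T.obj A) U).hom ≫ Ind.yoneda.map (ρ.hom.app A) ≫ a :=
    (isColimitBifunctorCoconeEval T V (Ind.yoneda.obj U)).fac _ (CostructuredArrow.mk a)
  rw [toExtendBifunctor, Category.assoc, h, ← Category.assoc,
    toExtendFunctor_comp_extendFunctorObjIso, Functor.map_comp, Category.assoc]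

instance isIso_extendUnit (ρ : T.flip.obj U ≅ 𝟭 C) (V : Ind C) : IsIso (extendUnit ρ V) := by
  refine isIso_of_bijective _ fun X => ⟨fun x x' h => ?_, fun a => ?_⟩
  · obtain ⟨A, B, a, b, ξ, ξ', rfl, rfl⟩ := exists_comp_toExtendBifunctor_eq₂ T x x'
    -- the object `U` of `C` is the last stage of `y U`, so only `V` has to be enlarged below
    obtain ⟨g, rfl⟩ := Ind.yoneda.map_surjective b
    have h1 : Ind.yoneda.map (ξ ≫ (T.obj A).map g ≫ ρ.hom.app A) ≫ a =
        Ind.yoneda.map (ξ' ≫ (T.obj A).map g ≫ ρ.hom.app A) ≫ a := by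
      simpa [toExtendBifunctor_comp_extendUnit] using h
    obtain ⟨A', a', f, rfl, h2⟩ := exists_comp_eq_of_comp_eq _ _ _ h1
    have h3 : ρ.hom.app A ≫ f = (T.map f).app U ≫ ρ.hom.app A' := (ρ.hom.naturality f).symm
    have h4 : ξ ≫ (T.map f).app B ≫ (T.obj A').map g =
        ξ' ≫ (T.map f).app B ≫ (T.obj A').map g := by
      rw [Category.assoc, Category.assoc, Category.assoc, Category.assoc, h3] at h2
      rw [← (T.map f).naturality g, ← cancel_mono (ρ.hom.app A')]
      simpa using h2
    have h5 := congrArg (Ind.yoneda.map · ≫ toExtendBifunctor T a' (𝟙 (Ind.yoneda.obj U))) h4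
    simpa [map_comp_toExtendBifunctor, map_app_comp_toExtendBifunctor] using h5
  · refine ⟨Ind.yoneda.map (ρ.inv.app X) ≫ toExtendBifunctor T a (Ind.yoneda.map (𝟙 U)), ?_⟩
    simp only [Category.assoc, toExtendBifunctor_comp_extendUnit]
    rw [← Functor.map_comp_assoc]
    simp

end ExtendBifunctor

end CategoryTheory.Ind

/-! ### `ℓ¹`-sums of Banach modules -/

lemma completeSpace_of_addEquiv {E F : Type*} [NormedAddCommGroup E] [NormedAddCommGroup F]
    [CompleteSpace E] (e : E ≃+ F) (c d : ℝ) (h : ∀ x, ‖e x‖ ≤ c * ‖x‖)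
    (h' : ∀ y, ‖e.symm y‖ ≤ d * ‖y‖) : CompleteSpace F :=
  (UniformEquiv.completeSpace_iff
    { e.toEquiv with
      uniformContinuous_toFun := (AddMonoidHomClass.lipschitz_of_bound e c h).uniformContinuous
      uniformContinuous_invFun :=
        (AddMonoidHomClass.lipschitz_of_bound e.symm d h').uniformContinuous }).1 inferInstance

namespace BanMod

variable {R : Type u} [BanachRing R]

section StdNorm

variable (M : BanMod R)

lemma bddAbove_norm_smul_div (m : M) : BddAbove (Set.range fun a : R => ‖a • m‖ / ‖a‖) := by
  obtain ⟨C, hC, h⟩ := M.exists_norm_smul_le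
  refine ⟨C * ‖m‖, ?_⟩
  rintro _ ⟨a, rfl⟩
  exact div_le_of_le_mul₀ (norm_nonneg _) (by positivity) ((h a m).trans_eq (by ring))

/-- The supremum of `‖a • m‖ / ‖a‖` over all `a : R`; the term `a = 0` contributes `0 / 0 = 0`. -/
noncomputable def actNorm (m : M) : ℝ := ⨆ a : R, ‖a • m‖ / ‖a‖

lemma norm_smul_le_actNorm (a : R) (m : M) : ‖a • m‖ ≤ ‖a‖ * actNorm M m := by
  rcases eq_or_ne a 0 with rfl | ha
  · simp
  · have h := le_ciSup (bddAbove_norm_smul_div M m) a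
    rwa [div_le_iff₀' (norm_pos_iff.2 ha)] at h

lemma actNorm_nonneg (m : M) : 0 ≤ actNorm M m :=
  Real.iSup_nonneg fun _ => by positivity

lemma actNorm_le {m : M} {c : ℝ} (hc : 0 ≤ c) (h : ∀ a : R, ‖a • m‖ ≤ c * ‖a‖) :
    actNorm M m ≤ c :=
  ciSup_le fun a => div_le_of_le_mul₀ (norm_nonneg _) hc (h a)

/-- An equivalent norm on a Banach module `M`, for which the constant bounding the action of `R`
depends on `R` only, scaled by a positive factor `w`. The uniform constant is what makes an
`ℓ¹`-sum of infinitely many Banach modules a Banach module again; the factor scales the norm because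
elements of `M` cannot be multiplied by real numbers. -/
noncomputable def scaledNorm (w : ℝ) (hw : 0 < w) : AddGroupNorm M where
  toFun m := w * (‖m‖ + actNorm M m)
  map_zero' := by
    have : actNorm M 0 = 0 := le_antisymm (actNorm_le M le_rfl (by simp)) (actNorm_nonneg M 0)
    simp [this]
  add_le' m n := by
    rw [← mul_add]
    have : actNorm M (m + n) ≤ actNorm M m + actNorm M n :=
      actNorm_le M (add_nonneg (actNorm_nonneg M m) (actNorm_nonneg M n)) fun a => by
        rw [smul_add, add_mul, mul_comm _ ‖a‖, mul_comm _ ‖a‖]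
        exact (norm_add_le _ _).trans
          (add_le_add (norm_smul_le_actNorm M a m) (norm_smul_le_actNorm M a n))
    exact mul_le_mul_of_nonneg_left (by linarith [norm_add_le m n]) hw.le
  neg' m := by simp [actNorm]
  eq_zero_of_map_eq_zero' m h := by
    have h1 := (mul_eq_zero_iff_left hw.ne').1 h
    exact norm_le_zero_iff.1 (by linarith [actNorm_nonneg M m])

lemma scaledNorm_apply (w : ℝ) (hw : 0 < w) (m : M) :
    scaledNorm M w hw m = w * (‖m‖ + actNorm M m) := rfl

lemma norm_le_inv_mul_scaledNorm (w : ℝ) (hw : 0 < w) (m : M) :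
    ‖m‖ ≤ w⁻¹ * scaledNorm M w hw m := by
  rw [le_inv_mul_iff₀ hw]
  exact mul_le_mul_of_nonneg_left (le_add_of_nonneg_right (actNorm_nonneg M m)) hw.le

lemma exists_scaledNorm_le :
    ∃ D : ℝ, 0 < D ∧ ∀ (w : ℝ) (hw : 0 < w) (m : M), scaledNorm M w hw m ≤ w * (D * ‖m‖) := by
  obtain ⟨C, hC, h⟩ := M.exists_norm_smul_le
  refine ⟨1 + C, by positivity, fun w hw m => mul_le_mul_of_nonneg_left ?_ hw.le⟩
  rw [add_mul, one_mul]
  exact add_le_add_right (actNorm_le M (by positivity) fun a => (h a m).trans_eq (by ring)) _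

lemma exists_scaledNorm_smul_le (R : Type u) [BanachRing R] :
    ∃ C : ℝ, 0 < C ∧ ∀ (M : BanMod R) (w : ℝ) (hw : 0 < w) (a : R) (m : M),
      scaledNorm M w hw (a • m) ≤ C * ‖a‖ * scaledNorm M w hw m := by
  obtain ⟨C, hC, h⟩ := BanachRing.exists_norm_mul_le (R := R)
  refine ⟨1 + C, by positivity, fun M w hw a m => ?_⟩
  have h1 : actNorm M (a • m) ≤ C * ‖a‖ * actNorm M m :=
    actNorm_le M (mul_nonneg (by positivity) (actNorm_nonneg M m)) fun b => by
      rw [smul_smul]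
      refine (norm_smul_le_actNorm M _ _).trans ?_
      refine (mul_le_mul_of_nonneg_right (h b a) (actNorm_nonneg M m)).trans_eq (by ring)
  have h2 := norm_smul_le_actNorm M a m
  have h3 : 0 ≤ C * ‖a‖ * ‖m‖ := by positivity
  rw [scaledNorm_apply, scaledNorm_apply, mul_left_comm]
  refine mul_le_mul_of_nonneg_left ?_ hw.le
  calc ‖a • m‖ + actNorm M (a • m) ≤ ‖a‖ * actNorm M m + C * ‖a‖ * actNorm M m := by gcongr
    _ ≤ (1 + C) * ‖a‖ * (‖m‖ + actNorm M m) := by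
      have : 0 ≤ ‖a‖ * ‖m‖ := by positivity
      linarith

/-- The Banach module `M` with the equivalent norm `scaledNorm`, with factor `2⁻ⁿ`. -/
noncomputable def scaled (n : ℕ) : BanMod R where
  carrier := M
  normedAddCommGroup := (scaledNorm M ((1 / 2) ^ n) (by positivity)).toNormedAddCommGroup
  module := M.module
  completeSpace := by
    obtain ⟨D, hD, h⟩ := exists_scaledNorm_le M
    refine @completeSpace_of_addEquiv M M M.normedAddCommGroup
      (scaledNorm M ((1 / 2) ^ n) (by positivity)).toNormedAddCommGroup M.completeSpace
      (AddEquiv.refl M) ((1 / 2) ^ n * D) ((1 / 2) ^ n)⁻¹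
      (fun m => (h _ _ m).trans_eq (mul_assoc _ _ _).symm) fun m => ?_
    exact norm_le_inv_mul_scaledNorm M _ _ m
  exists_norm_smul_le := by
    obtain ⟨C, hC, h⟩ := exists_scaledNorm_smul_le R
    exact ⟨C, hC, h M _ _⟩

lemma exists_norm_smul_scaled_le (R : Type u) [BanachRing R] :
    ∃ C : ℝ, 0 < C ∧ ∀ (M : BanMod R) (n : ℕ) (a : R) (m : M.scaled n),
      ‖a • m‖ ≤ C * ‖a‖ * ‖m‖ := by
  obtain ⟨C, hC, h⟩ := exists_scaledNorm_smul_le R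
  exact ⟨C, hC, fun M n => h M _ _⟩

/-- The identity map of `M`, as a bounded map onto `M.scaled n`. -/
noncomputable def toScaled (n : ℕ) : M ⟶ M.scaled n where
  toLinearMap := { toFun := fun m => m, map_add' := fun _ _ => rfl, map_smul' := fun _ _ => rfl }
  exists_norm_le := by
    obtain ⟨D, hD, h⟩ := exists_scaledNorm_le M
    exact ⟨(1 / 2) ^ n * D, by positivity, fun m => (h _ _ m).trans_eq (mul_assoc _ _ _).symm⟩

/-- The identity map of `M`, as a bounded map from `M.scaled n`. -/
noncomputable def ofScaled (n : ℕ) : M.scaled n ⟶ M where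
  toLinearMap := { toFun := fun m => m, map_add' := fun _ _ => rfl, map_smul' := fun _ _ => rfl }
  exists_norm_le :=
    ⟨((1 / 2) ^ n)⁻¹, by positivity, fun m => norm_le_inv_mul_scaledNorm M _ _ m⟩

lemma exists_norm_toScaled_le : ∃ D : ℝ, 0 < D ∧ ∀ (n : ℕ) (m : M),
    ‖(M.toScaled n).toLinearMap m‖ ≤ (1 / 2) ^ n * D * ‖m‖ := by
  obtain ⟨D, hD, h⟩ := exists_scaledNorm_le M
  exact ⟨D, hD, fun n m => (h _ _ m).trans_eq (mul_assoc _ _ _).symm⟩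

end StdNorm

section EllOne

variable {K : Type} (E : K → BanMod R)
  (hE : ∃ C : ℝ, 0 < C ∧ ∀ (k : K) (a : R) (m : E k), ‖a • m‖ ≤ C * ‖a‖ * ‖m‖)

lemma summable_norm_lp_one (f : lp (fun k => E k) 1) : Summable fun k => ‖f k‖ := by
  simpa using (lp.memℓp f).summable (by simp)

lemma norm_lp_one (f : lp (fun k => E k) 1) : ‖f‖ = ∑' k, ‖f k‖ := by
  simp [lp.norm_eq_tsum_rpow (p := 1) (by simp)]

include hE in
lemma memℓp_one_smul (a : R) (f : lp (fun k => E k) 1) : Memℓp (fun k => a • f k) 1 := by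
  obtain ⟨C, hC, h⟩ := hE
  refine memℓp_gen ?_
  simp only [ENNReal.toReal_one, Real.rpow_one]
  exact ((summable_norm_lp_one E f).mul_left (C * ‖a‖)).of_nonneg_of_le (fun _ => norm_nonneg _)
    fun k => h k a _

/-- The `ℓ¹`-sum of a family of Banach modules on which `R` acts with a uniform bound. -/
noncomputable def ellOne : BanMod R :=
  letI : SMul R (lp (fun k => E k) 1) := ⟨fun a f => ⟨fun k => a • f k, memℓp_one_smul E hE a f⟩⟩
  letI : Module R (PreLp fun k => E k) := inferInstanceAs (Module R (∀ k, E k))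
  letI : Module R (lp (fun k => E k) 1) :=
    Function.Injective.module R (AddSubgroup.subtype (lp (fun k => E k) 1))
      Subtype.val_injective fun _ _ => rfl
  { carrier := lp (fun k => E k) 1
    exists_norm_smul_le := by
      obtain ⟨C, hC, h⟩ := hE
      refine ⟨C, hC, fun a f => ?_⟩
      rw [norm_lp_one, norm_lp_one, ← tsum_mul_left]
      exact Summable.tsum_le_tsum (fun k => h k a (f k)) (summable_norm_lp_one E (a • f))
        ((summable_norm_lp_one E f).mul_left _) }

/-- The projection of the `ℓ¹`-sum onto a summand. -/
noncomputable def ellOneProj (k : K) : ellOne E hE ⟶ E k where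
  toLinearMap :=
    { toFun := fun f : lp (fun k => E k) 1 => f k
      map_add' := fun _ _ => rfl
      map_smul' := fun _ _ => rfl }
  exists_norm_le := ⟨1, one_pos, fun f => by
    rw [one_mul]; exact lp.norm_apply_le_norm (E := fun k => E k) one_ne_zero f k⟩

open scoped Classical in
/-- The inclusion of a summand into the `ℓ¹`-sum. -/
noncomputable def ellOneIncl (k : K) : E k ⟶ ellOne E hE where
  toLinearMap :=
    { toFun := fun m => (lp.single 1 k m : lp (fun k => E k) 1)
      map_add' := fun m n => lp.single_add (E := fun k => E k) 1 k m n
      map_smul' := fun a m => Subtype.ext (Pi.single_smul (f := fun k => E k) k a m) }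
  exists_norm_le := ⟨1, one_pos, fun m => by
    rw [one_mul]; exact (lp.norm_single (E := fun k => E k) one_pos k m).le⟩

lemma norm_ellOneIncl (k : K) (m : E k) : ‖(ellOneIncl E hE k).toLinearMap m‖ = ‖m‖ := by
  classical exact lp.norm_single (E := fun k => E k) one_pos k m

lemma ellOneIncl_comp_ellOneProj (k : K) : ellOneIncl E hE k ≫ ellOneProj E hE k = 𝟙 (E k) := by
  classical
  ext m
  exact Pi.single_eq_same (M := fun k => E k) k m

lemma ellOneProj_ellOneIncl_of_ne {k l : K} (h : l ≠ k) (m : E k) :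
    (ellOneProj E hE l).toLinearMap ((ellOneIncl E hE k).toLinearMap m) = 0 := by
  classical
  exact Pi.single_eq_of_ne (M := fun k => E k) h m

lemma ellOne_hasSum (f : ellOne E hE) :
    HasSum (fun k => (ellOneIncl E hE k).toLinearMap ((ellOneProj E hE k).toLinearMap f)) f := by
  classical
  exact lp.hasSum_single (E := fun k => E k) (p := 1) (by simp) f

/-- Truncation to finitely many summands does not increase the norm. -/
lemma norm_sum_ellOneIncl_le (f : ellOne E hE) (s : Finset K) :
    ‖∑ k ∈ s, (ellOneIncl E hE k).toLinearMap ((ellOneProj E hE k).toLinearMap f)‖ ≤ ‖f‖ := by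
  classical
  have h := lp.norm_sum_single (E := fun k => E k) (p := 1) (by simp) (fun k => f.1 k) s
  have h' := lp.sum_rpow_le_norm_rpow (E := fun k => E k) (p := 1) (by simp) f s
  simp only [ENNReal.toReal_one, Real.rpow_one] at h h'
  exact h.trans_le h'

end EllOne

end BanMod

/-! ### Weighted sums and the completed tensor product -/

namespace BanMod

variable {R : Type u} [BanachRing R]

/-- A continuous linear map on a completed tensor product is bounded by its values on elementary
tensors. -/
lemma norm_le_of_norm_tensorMk_le {M N P : BanMod R} (φ : tensor M N →ₗ[R] P) (hφ : Continuous φ)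
    {C : ℝ} (hC : 0 < C) (h : ∀ m n, ‖φ (tensorMk M N m n)‖ ≤ C * ‖m‖ * ‖n‖) (x : tensor M N) :
    ‖φ x‖ ≤ C * ‖x‖ := by
  induction x using UniformSpace.Completion.induction_on with
  | hp => exact isClosed_le hφ.norm (continuous_const.mul continuous_norm)
  | ih x =>
    refine (norm_le_projNorm (φ.toAddMonoidHom.comp
      (AddMonoidHomClass.toAddMonoidHom
        (NormedAddCommGroup.toCompl : NormedAddGroupHom (AlgTensor M N) _))) hC h x).trans_eq ?_
    exact congrArg (C * ·) (UniformSpace.Completion.norm_coe x).symm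

lemma norm_tensorMap_le {M N M' N' : BanMod R} (f : M ⟶ M') (g : N ⟶ N') {C D : ℝ} (hC : 0 < C)
    (hD : 0 < D) (hf : ∀ m, ‖f.toLinearMap m‖ ≤ C * ‖m‖) (hg : ∀ n, ‖g.toLinearMap n‖ ≤ D * ‖n‖)
    (x : tensor M N) : ‖(tensorMap f g).toLinearMap x‖ ≤ C * D * ‖x‖ := by
  refine norm_le_of_norm_tensorMk_le _ (Hom.continuous _) (mul_pos hC hD) (fun m n => ?_) x
  rw [tensorMap_mk]
  refine (norm_tensorMk_le _ _).trans ?_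
  calc ‖f.toLinearMap m‖ * ‖g.toLinearMap n‖ ≤ (C * ‖m‖) * (D * ‖n‖) :=
        mul_le_mul (hf m) (hg n) (norm_nonneg _) (by positivity)
    _ = C * D * ‖m‖ * ‖n‖ := by ring

/-- An absolutely convergent series of bounded linear maps has a sum. -/
lemma exists_hasSum {K : Type*} {Z Y : BanMod R} (h : K → (Z ⟶ Y)) (c : K → ℝ) (hc : Summable c)
    (hh : ∀ k z, ‖(h k).toLinearMap z‖ ≤ c k * ‖z‖) :
    ∃ g : Z ⟶ Y, ∀ z, HasSum (fun k => (h k).toLinearMap z) (g.toLinearMap z) := by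
  have hs : ∀ z, Summable fun k => (h k).toLinearMap z := fun z =>
    Summable.of_norm_bounded (hc.mul_right ‖z‖) fun k => hh k z
  have hsmul : ∀ a : R, Continuous fun y : Y => a • y := fun a => by
    obtain ⟨C, -, h⟩ := Y.exists_norm_smul_le
    exact AddMonoidHomClass.continuous_of_bound (DistribSMul.toAddMonoidHom Y a) (C * ‖a‖) (h a)
  have : ContinuousConstSMul R Y := ⟨hsmul⟩
  refine ⟨⟨{ toFun := fun z => ∑' k, (h k).toLinearMap z
             map_add' := fun z z' => ?_
             map_smul' := fun a z => ?_ }, |∑' k, c k| + 1, by positivity, fun z => ?_⟩,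
    fun z => (hs z).hasSum⟩
  · simp only [map_add]
    exact (hs z).tsum_add (hs z')
  · simp only [map_smul]
    exact (hs z).tsum_const_smul a
  · refine (tsum_of_norm_bounded ((hc.mul_right ‖z‖).hasSum) fun k => hh k z).trans ?_
    rw [tsum_mul_right]
    exact mul_le_mul_of_nonneg_right ((le_abs_self _).trans (by linarith)) (norm_nonneg _)

/-- A family of morphisms into the summands of a direct sum lifts to the direct sum, provided that
the corresponding series converges absolutely. -/
lemma exists_lift_of_summable {K : Type*} {Z Y : BanMod R} {E : K → BanMod R}
    (i : ∀ k, E k ⟶ Y) (p : ∀ k, Y ⟶ E k) (hip : ∀ k, i k ≫ p k = 𝟙 (E k))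
    (hip' : ∀ k l, l ≠ k → ∀ m, (p l).toLinearMap ((i k).toLinearMap m) = 0)
    (h : ∀ k, Z ⟶ E k) (c : K → ℝ) (hc : Summable c)
    (hh : ∀ k z, ‖(i k).toLinearMap ((h k).toLinearMap z)‖ ≤ c k * ‖z‖) :
    ∃ g : Z ⟶ Y, ∀ k, g ≫ p k = h k := by
  obtain ⟨g, hg⟩ := exists_hasSum (fun k => h k ≫ i k) c hc hh
  refine ⟨g, fun k => ?_⟩
  ext z
  have h1 := (hg z).map (p k).toLinearMap.toAddMonoidHom (Hom.continuous (p k))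
  refine h1.unique ?_
  have h2 : (p k).toLinearMap ((i k).toLinearMap ((h k).toLinearMap z)) = (h k).toLinearMap z :=
    congrArg (fun f : E k ⟶ E k => f.toLinearMap ((h k).toLinearMap z)) (hip k)
  rw [← h2]
  exact hasSum_single k fun l hl => hip' l k hl.symm _

section WeightedSum

variable {K : Type} (B : K → BanMod R) (n : K → ℕ)

/-- The `ℓ¹`-sum of the Banach modules `B k`, for the norm `∑ₖ 2^(-n k) * ‖b k‖` (up to replacing
the norm of each `B k` by an equivalent one, so that `R` acts with a uniform bound). -/
noncomputable def weightedSum : BanMod R :=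
  ellOne (fun k => (B k).scaled (n k)) (by
    obtain ⟨C, hC, h⟩ := exists_norm_smul_scaled_le R
    exact ⟨C, hC, fun k => h (B k) (n k)⟩)

/-- The projection of the weighted sum onto `B k`. -/
noncomputable def weightedSumProj (k : K) : weightedSum B n ⟶ B k :=
  ellOneProj (fun k => (B k).scaled (n k)) _ k ≫ (B k).ofScaled (n k)

/-- The inclusion of `B k` into the weighted sum. -/
noncomputable def weightedSumIncl (k : K) : B k ⟶ weightedSum B n :=
  (B k).toScaled (n k) ≫ ellOneIncl (fun k => (B k).scaled (n k)) _ k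

lemma weightedSumIncl_comp_weightedSumProj (k : K) :
    weightedSumIncl B n k ≫ weightedSumProj B n k = 𝟙 (B k) := by
  have h := ellOneIncl_comp_ellOneProj (fun k => (B k).scaled (n k)) (by
    obtain ⟨C, hC, h⟩ := exists_norm_smul_scaled_le R
    exact ⟨C, hC, fun k => h (B k) (n k)⟩) k
  exact congrArg (fun f => (B k).toScaled (n k) ≫ f ≫ (B k).ofScaled (n k)) h

lemma weightedSumProj_weightedSumIncl_of_ne (k l : K) (h : l ≠ k) (m : B k) :
    (weightedSumProj B n l).toLinearMap ((weightedSumIncl B n k).toLinearMap m) = 0 :=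
  ellOneProj_ellOneIncl_of_ne (fun k => (B k).scaled (n k)) _ h m

lemma weightedSum_hasSum (f : weightedSum B n) :
    HasSum (fun k => (weightedSumIncl B n k).toLinearMap ((weightedSumProj B n k).toLinearMap f))
      f :=
  ellOne_hasSum (fun k => (B k).scaled (n k)) _ f

lemma norm_sum_weightedSumIncl_le (f : weightedSum B n) (s : Finset K) :
    ‖∑ k ∈ s, (weightedSumIncl B n k).toLinearMap ((weightedSumProj B n k).toLinearMap f)‖ ≤ ‖f‖ :=
  norm_sum_ellOneIncl_le (fun k => (B k).scaled (n k)) _ f s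

/-- The inclusion of `B k` has norm at most `2^(-n k) * D`, with `D` independent of the weights. -/
lemma exists_norm_weightedSumIncl_le (k : K) : ∃ D : ℝ, 0 < D ∧ ∀ (n : K → ℕ) (m : B k),
    ‖(weightedSumIncl B n k).toLinearMap m‖ ≤ (1 / 2) ^ n k * D * ‖m‖ := by
  obtain ⟨D, hD, h⟩ := exists_norm_toScaled_le (B k)
  refine ⟨D, hD, fun n m => ?_⟩
  exact (norm_ellOneIncl (fun k => (B k).scaled (n k)) _ k _).trans_le (h (n k) m)

lemma weightedSum_hom_ext {Z : BanMod R} {f g : Z ⟶ weightedSum B n}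
    (h : ∀ k, f ≫ weightedSumProj B n k = g ≫ weightedSumProj B n k) : f = g := by
  ext z
  have h1 := weightedSum_hasSum B n (f.toLinearMap z)
  have h2 : ∀ k, (weightedSumProj B n k).toLinearMap (f.toLinearMap z) =
      (weightedSumProj B n k).toLinearMap (g.toLinearMap z) := fun k =>
    congrArg (fun φ : Z ⟶ B k => φ.toLinearMap z) (h k)
  simp only [h2] at h1
  exact h1.unique (weightedSum_hasSum B n (g.toLinearMap z))

/-- An element of `A ⊗̂ S`, with `S` a weighted sum of the `B k`, is zero if its images in the
`A ⊗̂ B k` are: the truncations to finitely many summands have norm at most `1` and converge to the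
identity on elementary tensors, hence everywhere. -/
lemma eq_zero_of_tensorMap_weightedSumProj {A : BanMod R} (z : tensor A (weightedSum B n))
    (hz : ∀ k, (tensorMap (𝟙 A) (weightedSumProj B n k)).toLinearMap z = 0) : z = 0 := by
  -- the truncation of a tensor to finitely many summands
  let P (s : Finset K) : tensor A (weightedSum B n) →ₗ[R] tensor A (weightedSum B n) :=
    ∑ k ∈ s, (tensorMap (𝟙 A) (weightedSumIncl B n k)).toLinearMap ∘ₗ
      (tensorMap (𝟙 A) (weightedSumProj B n k)).toLinearMap
  have hPapply (s : Finset K) (x) : P s x = ∑ k ∈ s,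
      (tensorMap (𝟙 A) (weightedSumIncl B n k)).toLinearMap
        ((tensorMap (𝟙 A) (weightedSumProj B n k)).toLinearMap x) := by
    simp [P]
  have hPmk (s : Finset K) (a : A) (f : weightedSum B n) : P s (tensorMk _ _ a f) =
      tensorMk _ _ a (∑ k ∈ s,
        (weightedSumIncl B n k).toLinearMap ((weightedSumProj B n k).toLinearMap f)) := by
    simp [hPapply, tensorMap_mk]
  have hPc (s : Finset K) : Continuous (P s) := by
    simp only [funext (hPapply s)]
    exact continuous_finsetSum _ fun k _ => (Hom.continuous _).comp (Hom.continuous _)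
  have hPn (s : Finset K) (x) : ‖P s x‖ ≤ ‖x‖ := by
    have := norm_le_of_norm_tensorMk_le (P s) (hPc s) one_pos (fun a f => by
      rw [hPmk, one_mul]
      exact (norm_tensorMk_le _ _).trans (mul_le_mul_of_nonneg_left
        (norm_sum_weightedSumIncl_le B n f s) (norm_nonneg _))) x
    rwa [one_mul] at this
  have hPz (s : Finset K) : P s z = 0 := by simp [hPapply, hz]
  have hPt (x : AlgTensor A (weightedSum B n)) : Filter.Tendsto
      (fun s => P s (x : UniformSpace.Completion (AlgTensor A (weightedSum B n)))) Filter.atTop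
      (nhds (x : UniformSpace.Completion (AlgTensor A (weightedSum B n)))) := by
    induction x using AlgTensor.induction with
    | zero =>
      rw [UniformSpace.Completion.coe_zero]
      exact tendsto_const_nhds.congr fun s => (map_zero (P s)).symm
    | mk a f =>
      have hc : Continuous (tensorMk A (weightedSum B n) a) :=
        AddMonoidHomClass.continuous_of_bound _ ‖a‖ fun f => norm_tensorMk_le a f
      have h1 := (hc.tendsto f).comp (weightedSum_hasSum B n f)
      exact h1.congr fun s => (hPmk s a f).symm
    | add x y hx hy =>
      rw [UniformSpace.Completion.coe_add]
      exact (hx.add hy).congr fun s => (map_add (P s) _ _).symm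
  refine norm_le_zero_iff.1 (le_of_forall_pos_le_add fun ε hε => ?_)
  obtain ⟨x, hx⟩ := (UniformSpace.Completion.denseRange_coe
    (α := AlgTensor A (weightedSum B n))).exists_dist_lt z (half_pos hε)
  set x' : tensor A (weightedSum B n) :=
    (x : UniformSpace.Completion (AlgTensor A (weightedSum B n)))
  have h1 : ‖x' - z‖ ≤ ε / 2 := by
    rw [← dist_eq_norm, dist_comm]; exact hx.le
  have h2 : ‖x'‖ ≤ ε / 2 := le_of_tendsto (hPt x).norm (Filter.Eventually.of_forall fun s => by
    have h3 := hPn s (x' - z)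
    rw [map_sub, hPz, sub_zero] at h3
    exact h3.trans h1)
  have h4 := norm_sub_le x' (x' - z)
  rw [sub_sub_cancel] at h4
  linarith

lemma tensor_weightedSum_hom_ext {A Z : BanMod R}
    {f g : Z ⟶ ((tensorFunctor R).obj A).obj (weightedSum B n)}
    (h : ∀ k, f ≫ ((tensorFunctor R).obj A).map (weightedSumProj B n k) =
      g ≫ ((tensorFunctor R).obj A).map (weightedSumProj B n k)) : f = g := by
  ext z
  refine sub_eq_zero.1 (eq_zero_of_tensorMap_weightedSumProj B n _ fun k => ?_)
  exact (map_sub (tensorMap (𝟙 A) (weightedSumProj B n k)).toLinearMap _ _).trans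
    (sub_eq_zero.2 (congrArg (fun φ : Z ⟶ tensor A (B k) => φ.toLinearMap z) (h k)))

variable [Countable K]

/-- Any bounds `c k` become summable after scaling by sufficiently small weights. -/
lemma exists_weight (c : K → ℝ) :
    ∃ n₀ : K → ℕ, ∀ n, n₀ ≤ n → ∃ d : K → ℝ, Summable d ∧ ∀ k, (1 / 2) ^ n k * c k ≤ d k := by
  have := Encodable.ofCountable K
  choose N hN using fun k => pow_unbounded_of_one_lt (c k) (one_lt_two (α := ℝ))
  -- `2^(-N k)` absorbs `c k`, and the remaining factors `2^(-encode k)` are summable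
  refine ⟨fun k => N k + Encodable.encode k, fun n hn => ⟨fun k => (1 / 2) ^ Encodable.encode k,
    summable_geometric_two_encode, fun k => ?_⟩⟩
  calc (1 / 2 : ℝ) ^ n k * c k ≤ (1 / 2) ^ n k * 2 ^ N k :=
        mul_le_mul_of_nonneg_left (hN k).le (by positivity)
    _ ≤ (1 / 2) ^ (N k + Encodable.encode k) * 2 ^ N k :=
        mul_le_mul_of_nonneg_right
          (pow_le_pow_of_le_one (by norm_num) (by norm_num) (hn k)) (by positivity)
    _ = (1 / 2) ^ Encodable.encode k := by
        rw [pow_add, mul_right_comm, ← mul_pow]; norm_num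

/-- Countably many morphisms `Z ⟶ B k` define a morphism to the weighted sum, if the weights are
small enough. -/
lemma exists_weightedSum_lift {Z : BanMod R} (h : ∀ k, Z ⟶ B k) :
    ∃ n₀ : K → ℕ, ∀ n, n₀ ≤ n →
      ∃ g : Z ⟶ weightedSum B n, ∀ k, g ≫ weightedSumProj B n k = h k := by
  choose D hD hi using exists_norm_weightedSumIncl_le B
  choose C hC hh using fun k => (h k).exists_norm_le
  obtain ⟨n₀, hn₀⟩ := exists_weight fun k => D k * C k
  refine ⟨n₀, fun n hn => ?_⟩
  obtain ⟨d, hd, hd'⟩ := hn₀ n hn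
  refine exists_lift_of_summable (weightedSumIncl B n) (weightedSumProj B n)
    (weightedSumIncl_comp_weightedSumProj B n) (weightedSumProj_weightedSumIncl_of_ne B n) h d hd
    fun k z => ?_
  refine (hi k n _).trans ?_
  have h1 := mul_le_mul_of_nonneg_left (hh k z) (hD k).le
  have h2 := mul_le_mul_of_nonneg_right (hd' k) (norm_nonneg z)
  have h3 := mul_le_mul_of_nonneg_left h1 (by positivity : (0:ℝ) ≤ (1 / 2) ^ n k)
  linarith

/-- Countably many morphisms `Z ⟶ A ⊗̂ B k` define a morphism to `A ⊗̂ S`, where `S` is the weighted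
sum of the `B k`, if the weights are small enough. -/
lemma exists_tensor_weightedSum_lift {Z A : BanMod R}
    (h : ∀ k, Z ⟶ ((tensorFunctor R).obj A).obj (B k)) :
    ∃ n₀ : K → ℕ, ∀ n, n₀ ≤ n →
      ∃ g : Z ⟶ ((tensorFunctor R).obj A).obj (weightedSum B n),
        ∀ k, g ≫ ((tensorFunctor R).obj A).map (weightedSumProj B n k) = h k := by
  change ∀ k, Z ⟶ tensor A (B k) at h
  choose D hD hi using exists_norm_weightedSumIncl_le B
  choose C hC hh using fun k => (h k).exists_norm_le
  obtain ⟨n₀, hn₀⟩ := exists_weight fun k => D k * C k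
  refine ⟨n₀, fun n hn => ?_⟩
  obtain ⟨d, hd, hd'⟩ := hn₀ n hn
  refine exists_lift_of_summable (E := fun k => tensor A (B k))
    (fun k => tensorMap (𝟙 A) (weightedSumIncl B n k))
    (fun k => tensorMap (𝟙 A) (weightedSumProj B n k)) (fun k => ?_) (fun k l hkl m => ?_) h d hd
    fun k z => ?_
  · refine (((tensorFunctor R).obj A).map_comp _ _).symm.trans ?_
    rw [weightedSumIncl_comp_weightedSumProj]
    exact ((tensorFunctor R).obj A).map_id _
  · let φ : tensor A (B k) ⟶ tensor A (B l) := ⟨0, 1, one_pos, fun m => by simp⟩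
    have hφ : tensorMap (𝟙 A) (weightedSumIncl B n k) ≫ tensorMap (𝟙 A) (weightedSumProj B n l) =
        φ := tensor_hom_ext fun a b => by
      simp [tensorMap_mk, weightedSumProj_weightedSumIncl_of_ne B n k l hkl, φ]
    exact congrArg (fun ψ : tensor A (B k) ⟶ tensor A (B l) => ψ.toLinearMap m) hφ
  · refine (norm_tensorMap_le (𝟙 A) (weightedSumIncl B n k) one_pos (by have := hD k; positivity)
      (fun a => (one_mul _).ge) (hi k n) _).trans ?_
    have h1 := mul_le_mul_of_nonneg_left (hh k z) (hD k).le
    have h2 := mul_le_mul_of_nonneg_right (hd' k) (norm_nonneg z)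
    have h3 := mul_le_mul_of_nonneg_left h1 (by positivity : (0:ℝ) ≤ (1 / 2) ^ n k)
    linarith

end WeightedSum

end BanMod

/-! ### Countable products of ind-objects, and metrizability -/

namespace BanMod

variable {R : Type u} [BanachRing R]

section Products

variable {K : Type} (B : ULift.{u} K → BanMod R)

/-- The components of a morphism from a representable presheaf to a product of representable
presheaves. -/
noncomputable def piComponent (j : CostructuredArrow yoneda (∏ᶜ yoneda.obj ∘ B)) (k : K) :
    j.left ⟶ B ⟨k⟩ :=
  yoneda.preimage (j.hom ≫ Pi.π (yoneda.obj ∘ B) ⟨k⟩)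

lemma map_piComponent (j : CostructuredArrow yoneda (∏ᶜ yoneda.obj ∘ B)) (k : K) :
    yoneda.map (piComponent B j k) = j.hom ≫ Pi.π (yoneda.obj ∘ B) ⟨k⟩ :=
  yoneda.map_preimage _

/-- The weighted sum of the `B k`, as an object over the product of the presheaves represented by
the `B k`. -/
noncomputable def weightedSumOver (n : K → ℕ) :
    CostructuredArrow yoneda (∏ᶜ yoneda.obj ∘ B) :=
  CostructuredArrow.mk (Y := weightedSum (fun k => B ⟨k⟩) n)
    (Pi.lift fun k => yoneda.map (weightedSumProj (fun k => B ⟨k⟩) n k.down))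

lemma piComponent_weightedSumOver (n : K → ℕ) (k : K) :
    piComponent B (weightedSumOver B n) k = weightedSumProj (fun k => B ⟨k⟩) n k := by
  apply yoneda.map_injective
  rw [map_piComponent]
  exact Pi.lift_π _ _

variable [Countable K]

/-- The weighted sums are cofinal among the objects over the product of the presheaves represented
by the `B k`. -/
lemma exists_hom_weightedSumOver (j : CostructuredArrow yoneda (∏ᶜ yoneda.obj ∘ B)) :
    ∃ n₀ : K → ℕ, ∀ n, n₀ ≤ n → Nonempty (j ⟶ weightedSumOver B n) := by
  obtain ⟨n₀, h⟩ := exists_weightedSum_lift (fun k => B ⟨k⟩) (piComponent B j)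
  refine ⟨n₀, fun n hn => ?_⟩
  obtain ⟨g, hg⟩ := h n hn
  refine ⟨CostructuredArrow.homMk g (Pi.hom_ext _ _ fun k => ?_)⟩
  rw [Category.assoc, ← map_piComponent, ← map_piComponent, piComponent_weightedSumOver]
  exact (yoneda.map_comp g _).symm.trans (congrArg _ (hg k.down))

/-- A countable product of presheaves represented by Banach modules is an ind-object: it is the
filtered colimit of the weighted sums, over all weights. -/
lemma isIndObject_pi_yoneda : IsIndObject (∏ᶜ yoneda.obj ∘ B) := by
  have : IsFiltered (CostructuredArrow yoneda (∏ᶜ yoneda.obj ∘ B)) :=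
    { nonempty := ⟨weightedSumOver B 0⟩
      cocone_objs := fun j j' => by
        obtain ⟨n, hn⟩ := exists_hom_weightedSumOver B j
        obtain ⟨n', hn'⟩ := exists_hom_weightedSumOver B j'
        exact ⟨_, (hn _ (le_sup_left (b := n'))).some, (hn' _ (le_sup_right (a := n))).some,
          trivial⟩
      cocone_maps := fun j j' f f' => by
        obtain ⟨n, hn⟩ := exists_hom_weightedSumOver B j'
        let q := (hn n le_rfl).some
        refine ⟨_, q, CostructuredArrow.hom_ext _ _ (weightedSum_hom_ext _ _ fun k => ?_)⟩
        apply yoneda.map_injective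
        have h : ∀ r : j ⟶ weightedSumOver B n,
            yoneda.map (r.left ≫ weightedSumProj (fun k => B ⟨k⟩) n k) =
              j.hom ≫ Pi.π (yoneda.obj ∘ B) ⟨k⟩ := fun r => by
          rw [← piComponent_weightedSumOver, Functor.map_comp, map_piComponent,
            CostructuredArrow.w_assoc]
        exact (h _).trans (h _).symm }
  refine (isIndObject_iff _).2 ⟨this, finallySmall_of_small_weakly_terminal_set
    (Set.range (weightedSumOver B)) fun j => ?_⟩
  obtain ⟨n, hn⟩ := exists_hom_weightedSumOver B j
  exact ⟨_, ⟨n, rfl⟩, hn n le_rfl⟩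

variable (R K) in
lemma isClosedUnderLimitsOfShape_isIndObject :
    ObjectProperty.IsClosedUnderLimitsOfShape (IsIndObject (C := BanMod R))
      (Discrete (ULift.{u} K)) :=
  .mk' (by
    rintro _ ⟨F, hF⟩
    exact isIndObject_limit_of_discrete (fun g => isIndObject_pi_yoneda g) F hF)

variable (R K) in
/-- Countable products of ind-objects are computed in presheaves. -/
@[reducible] noncomputable def createsCountableProducts :
    CreatesLimitsOfShape (Discrete (ULift.{u} K)) (Ind.inclusion (BanMod R)) :=
  have := isClosedUnderLimitsOfShape_isIndObject R K
  inferInstanceAs <|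
    CreatesLimitsOfShape (Discrete (ULift.{u} K))
      ((Ind.equivalence (BanMod R)).functor ⋙ ObjectProperty.ι _)

variable (R) in
lemma hasCountableProducts_ind : HasCountableProducts (Ind (BanMod R)) where
  out K _ := by
    have := createsCountableProducts R K
    have : HasLimitsOfShape (Discrete (ULift.{u} K)) (Ind (BanMod R)) :=
      hasLimitsOfShape_of_hasLimitsOfShape_createsLimitsOfShape (Ind.inclusion (BanMod R))
    exact hasLimitsOfShape_of_equivalence (Discrete.equivalence Equiv.ulift)

end Products

end BanMod

namespace CategoryTheory.Ind

universe v w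

variable {C : Type w} [Category.{v} C] {V : Ind C}

section Metrizable

lemma hasCardinalLT_aleph_one (K : Type*) [Countable K] :
    HasCardinalLT K (Cardinal.aleph 1 : Cardinal.{0}) := by
  simp [HasCardinalLT, Cardinal.lt_aleph_one_iff]

/-- Countably many objects over a metrizable ind-object map to a common one. -/
lemma IsMetrizable.exists_common (hV : V.IsMetrizable) {K : Type*} [Countable K] (A : K → C)
    (a : ∀ k, Ind.yoneda.obj (A k) ⟶ V) :
    ∃ (D : C) (d : Ind.yoneda.obj D ⟶ V) (f : ∀ k, A k ⟶ D),
      ∀ k, Ind.yoneda.map (f k) ≫ d = a k := by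
  have : Fact (Cardinal.aleph 1 : Cardinal.{0}).IsRegular := ⟨Cardinal.isRegular_aleph_one⟩
  have : IsCardinalFiltered (CostructuredArrow Ind.yoneda V) (Cardinal.aleph 1 : Cardinal.{0}) := hV
  have hK := hasCardinalLT_aleph_one K
  let S k := CostructuredArrow.mk (a k)
  exact ⟨(IsCardinalFiltered.max S hK).left, (IsCardinalFiltered.max S hK).hom,
    fun k => (IsCardinalFiltered.toMax S hK k).left,
    fun k => CostructuredArrow.w (IsCardinalFiltered.toMax S hK k)⟩

/-- Countably many morphisms over a metrizable ind-object with the same source become equal. -/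
lemma IsMetrizable.exists_wideSpan (hV : V.IsMetrizable) {K : Type*} [Countable K] {A : C}
    (a : Ind.yoneda.obj A ⟶ V) {A' : K → C} (a' : ∀ k, Ind.yoneda.obj (A' k) ⟶ V)
    (f : ∀ k, A ⟶ A' k) (hf : ∀ k, Ind.yoneda.map (f k) ≫ a' k = a) :
    ∃ (D : C) (d : Ind.yoneda.obj D ⟶ V) (h : A ⟶ D) (g : ∀ k, A' k ⟶ D),
      Ind.yoneda.map h ≫ d = a ∧ ∀ k, f k ≫ g k = h := by
  have : Fact (Cardinal.aleph 1 : Cardinal.{0}).IsRegular := ⟨Cardinal.isRegular_aleph_one⟩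
  have : IsCardinalFiltered (CostructuredArrow Ind.yoneda V) (Cardinal.aleph 1 : Cardinal.{0}) := hV
  obtain ⟨m, g, h, hm⟩ := IsCardinalFiltered.wideSpan
    (fun k => (CostructuredArrow.homMk (f k) (hf k) :
      CostructuredArrow.mk a ⟶ CostructuredArrow.mk (a' k))) (hasCardinalLT_aleph_one K)
  exact ⟨m.left, m.hom, h.left, fun k => (g k).left, CostructuredArrow.w h,
    fun k => congrArg (·.left) (hm k)⟩

/-- It suffices to check metrizability on families indexed by `ℤ`, since `ℤ` maps onto every
nonempty countable set. -/
lemma isMetrizable_of_int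
    (h₁ : ∀ (A : ℤ → C) (a : ∀ n, Ind.yoneda.obj (A n) ⟶ V),
      ∃ (D : C) (d : Ind.yoneda.obj D ⟶ V) (f : ∀ n, A n ⟶ D),
        ∀ n, Ind.yoneda.map (f n) ≫ d = a n)
    (h₂ : ∀ (X Y : C) (b : Ind.yoneda.obj Y ⟶ V) (f : ℤ → (X ⟶ Y)) (f' : X ⟶ Y),
      (∀ n, Ind.yoneda.map (f n) ≫ b = Ind.yoneda.map f' ≫ b) →
      ∃ (D : C) (d : Ind.yoneda.obj D ⟶ V) (g : Y ⟶ D),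
        Ind.yoneda.map g ≫ d = b ∧ ∀ n, f n ≫ g = f' ≫ g) : V.IsMetrizable := by
  have hsurj : ∀ (ι : Type) [Nonempty ι], HasCardinalLT ι (Cardinal.aleph 1 : Cardinal.{0}) →
      ∃ e : ℤ → ι, Function.Surjective e := fun ι _ hι => by
    have : Countable ι := by
      rw [hasCardinalLT_iff_cardinal_mk_lt, Cardinal.lt_aleph_one_iff, Cardinal.mk_le_aleph0_iff]
        at hι
      exact hι
    obtain ⟨e, he⟩ := exists_surjective_nat ι
    exact ⟨e ∘ Int.natAbs, he.comp Int.natAbs_surjective⟩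
  have : Fact (Cardinal.aleph 1 : Cardinal.{0}).IsRegular := ⟨Cardinal.isRegular_aleph_one⟩
  refine (isCardinalFiltered_iff _ _).2 ⟨fun ι j hι => ?_, fun ι j k f hι => ?_⟩
  · cases isEmpty_or_nonempty ι
    · exact ⟨IsFiltered.nonempty.some, fun i => isEmptyElim i⟩
    · obtain ⟨e, he⟩ := hsurj ι hι
      obtain ⟨D, d, f, hf⟩ := h₁ (fun n => (j (e n)).left) (fun n => (j (e n)).hom)
      refine ⟨CostructuredArrow.mk d, fun i => ?_⟩
      obtain ⟨n, rfl⟩ := he i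
      exact ⟨CostructuredArrow.homMk (f n) (hf n)⟩
  · cases isEmpty_or_nonempty ι
    · exact ⟨IsFiltered.max j k, IsFiltered.rightToMax j k, IsFiltered.leftToMax j k,
        fun i => isEmptyElim i⟩
    · obtain ⟨e, he⟩ := hsurj ι hι
      obtain ⟨D, d, g, hg, h⟩ := h₂ j.left k.left k.hom (fun n => (f (e n)).left) (f (e 0)).left
        fun n => by rw [CostructuredArrow.w, CostructuredArrow.w]
      let q : k ⟶ CostructuredArrow.mk d := CostructuredArrow.homMk g hg
      refine ⟨CostructuredArrow.mk d, q, f (e 0) ≫ q, fun i => ?_⟩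
      obtain ⟨n, rfl⟩ := he i
      exact CostructuredArrow.hom_ext _ _ (h n)

end Metrizable

end CategoryTheory.Ind

/-! ### Tensoring with a metrizable ind-object -/

section

open BanMod Ind

variable {R : Type u} [BanachRing R] {V : Ind (BanMod R)}

/-- The morphism `A ⊗̂ B ⟶ V ⊗̂ W` attached to objects `a : A ⟶ V` over `V` and `b : B ⟶ W`
over `W`. -/
noncomputable def toIndTensor {W : Ind (BanMod R)} {A B : BanMod R} (a : Ind.yoneda.obj A ⟶ V)
    (b : Ind.yoneda.obj B ⟶ W) :
    Ind.yoneda.obj (((tensorFunctor R).obj A).obj B) ⟶ ((indTensor R).obj V).obj W :=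
  toExtendBifunctor (tensorFunctor R) a b

section ToIndTensor

variable {W : Ind (BanMod R)}

lemma toIndTensor_comp_map {W' : Ind (BanMod R)} {A B : BanMod R} (a : Ind.yoneda.obj A ⟶ V)
    (b : Ind.yoneda.obj B ⟶ W) (w : W ⟶ W') :
    toIndTensor a b ≫ ((indTensor R).obj V).map w = toIndTensor a (b ≫ w) :=
  toExtendBifunctor_comp_map _ a b w

lemma map_app_comp_toIndTensor {A A' B : BanMod R} (f : A ⟶ A') (a : Ind.yoneda.obj A' ⟶ V)
    (b : Ind.yoneda.obj B ⟶ W) :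
    Ind.yoneda.map (((tensorFunctor R).map f).app B) ≫ toIndTensor a b =
      toIndTensor (Ind.yoneda.map f ≫ a) b :=
  map_app_comp_toExtendBifunctor _ f a b

lemma map_comp_toIndTensor {A B B' : BanMod R} (g : B ⟶ B') (a : Ind.yoneda.obj A ⟶ V)
    (b : Ind.yoneda.obj B' ⟶ W) :
    Ind.yoneda.map (((tensorFunctor R).obj A).map g) ≫ toIndTensor a b =
      toIndTensor a (Ind.yoneda.map g ≫ b) :=
  map_comp_toExtendBifunctor _ g a b

lemma exists_comp_toIndTensor_eq {X : BanMod R}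
    (x : Ind.yoneda.obj X ⟶ ((indTensor R).obj V).obj W) :
    ∃ (A B : BanMod R) (a : Ind.yoneda.obj A ⟶ V) (b : Ind.yoneda.obj B ⟶ W)
      (ξ : X ⟶ ((tensorFunctor R).obj A).obj B), Ind.yoneda.map ξ ≫ toIndTensor a b = x :=
  exists_comp_toExtendBifunctor_eq _ x

lemma exists_comp_toIndTensor_eq₂ {X X' : BanMod R}
    (x : Ind.yoneda.obj X ⟶ ((indTensor R).obj V).obj W)
    (x' : Ind.yoneda.obj X' ⟶ ((indTensor R).obj V).obj W) :
    ∃ (A B : BanMod R) (a : Ind.yoneda.obj A ⟶ V) (b : Ind.yoneda.obj B ⟶ W)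
      (ξ : X ⟶ ((tensorFunctor R).obj A).obj B) (ξ' : X' ⟶ ((tensorFunctor R).obj A).obj B),
      Ind.yoneda.map ξ ≫ toIndTensor a b = x ∧ Ind.yoneda.map ξ' ≫ toIndTensor a b = x' :=
  exists_comp_toExtendBifunctor_eq₂ _ x x'

lemma exists_comp_map_eq_of_toIndTensor {X A B : BanMod R}
    (a : Ind.yoneda.obj A ⟶ V) (b : Ind.yoneda.obj B ⟶ W)
    {ξ ξ' : X ⟶ ((tensorFunctor R).obj A).obj B}
    (h : Ind.yoneda.map ξ ≫ toIndTensor a b = Ind.yoneda.map ξ' ≫ toIndTensor a b) :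
    ∃ (A' B' : BanMod R) (a' : Ind.yoneda.obj A' ⟶ V) (b' : Ind.yoneda.obj B' ⟶ W) (f : A ⟶ A')
      (g : B ⟶ B'), Ind.yoneda.map f ≫ a' = a ∧ Ind.yoneda.map g ≫ b' = b ∧
        ξ ≫ ((tensorFunctor R).map f).app B ≫ ((tensorFunctor R).obj A').map g =
          ξ' ≫ ((tensorFunctor R).map f).app B ≫ ((tensorFunctor R).obj A').map g :=
  exists_comp_map_eq_of_toExtendBifunctor _ a b h

end ToIndTensor

/-- If `V` is metrizable, every countable family of elements of the `V ⊗̂ W k` comes from an element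
of `V ⊗̂ ∏ W k`. -/
lemma exists_indTensor_lift (hV : V.IsMetrizable) {K : Type} [Countable K]
    (W : K → Ind (BanMod R)) [HasProduct W] {X : BanMod R}
    (y : ∀ k, Ind.yoneda.obj X ⟶ ((indTensor R).obj V).obj (W k)) :
    ∃ x : Ind.yoneda.obj X ⟶ ((indTensor R).obj V).obj (∏ᶜ W),
      ∀ k, x ≫ ((indTensor R).obj V).map (Pi.π W k) = y k := by
  choose A B a b ξ hξ using fun k => exists_comp_toIndTensor_eq (y k)
  obtain ⟨D, d, f, hf⟩ := hV.exists_common A a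
  obtain ⟨n, hn⟩ := exists_tensor_weightedSum_lift B
    fun k => ξ k ≫ ((tensorFunctor R).map (f k)).app (B k)
  obtain ⟨g, hg⟩ := hn n le_rfl
  refine ⟨Ind.yoneda.map g ≫ toIndTensor d
    (Pi.lift fun k => Ind.yoneda.map (weightedSumProj B n k) ≫ b k), fun k => ?_⟩
  rw [Category.assoc, toIndTensor_comp_map, Pi.lift_π, ← map_comp_toIndTensor,
    ← Functor.map_comp_assoc, hg, Functor.map_comp_assoc, map_app_comp_toIndTensor, hf, hξ]

/-- If `V` is metrizable, the elements of `V ⊗̂ ∏ W k` are determined by their components. -/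
lemma indTensor_pi_ext (hV : V.IsMetrizable) {K : Type} [Countable K]
    (W : K → Ind (BanMod R)) [HasProduct W] {X : BanMod R}
    {x x' : Ind.yoneda.obj X ⟶ ((indTensor R).obj V).obj (∏ᶜ W)}
    (h : ∀ k, x ≫ ((indTensor R).obj V).map (Pi.π W k) =
      x' ≫ ((indTensor R).obj V).map (Pi.π W k)) : x = x' := by
  obtain ⟨A, B, a, b, ξ, ξ', rfl, rfl⟩ :=
    exists_comp_toIndTensor_eq₂ x x'
  simp only [Category.assoc, toIndTensor_comp_map] at h
  choose A' B' a' b' f g hf hg hξ using fun k =>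
    exists_comp_map_eq_of_toIndTensor a (b ≫ Pi.π W k) (h k)
  obtain ⟨D, d, q, r, hq, hr⟩ := hV.exists_wideSpan a a' f hf
  obtain ⟨n, hn⟩ := exists_weightedSum_lift B' g
  obtain ⟨s, hs⟩ := hn n le_rfl
  have hb : Ind.yoneda.map s ≫
      Pi.lift (fun k => Ind.yoneda.map (weightedSumProj B' n k) ≫ b' k) = b :=
    Pi.hom_ext _ _ fun k => by
      rw [Category.assoc, Pi.lift_π, ← Functor.map_comp_assoc, hs, hg]
  -- the components in the `D ⊗̂ B' k` agree, because they do so in the `A' k ⊗̂ B' k`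
  have key : ξ ≫ ((tensorFunctor R).map q).app B ≫ ((tensorFunctor R).obj D).map s =
      ξ' ≫ ((tensorFunctor R).map q).app B ≫ ((tensorFunctor R).obj D).map s := by
    refine tensor_weightedSum_hom_ext B' n fun k => ?_
    have h1 : ((tensorFunctor R).map q).app B ≫ ((tensorFunctor R).obj D).map s ≫
        ((tensorFunctor R).obj D).map (weightedSumProj B' n k) =
        (((tensorFunctor R).map (f k)).app B ≫ ((tensorFunctor R).obj (A' k)).map (g k)) ≫
          ((tensorFunctor R).map (r k)).app (B' k) := by
      rw [← Functor.map_comp, hs, ← hr k, Functor.map_comp, NatTrans.comp_app, Category.assoc,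
        Category.assoc, ((tensorFunctor R).map (r k)).naturality]
    have h2 : ∀ η : X ⟶ ((tensorFunctor R).obj A).obj B,
        (η ≫ ((tensorFunctor R).map q).app B ≫ ((tensorFunctor R).obj D).map s) ≫
          ((tensorFunctor R).obj D).map (weightedSumProj B' n k) =
        (η ≫ ((tensorFunctor R).map (f k)).app B ≫ ((tensorFunctor R).obj (A' k)).map (g k)) ≫
          ((tensorFunctor R).map (r k)).app (B' k) := fun η => by
      simp only [Category.assoc, h1]
    exact (h2 ξ).trans ((congrArg (· ≫ _) (hξ k)).trans (h2 ξ').symm)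
  have h3 := congrArg (Ind.yoneda.map · ≫ toIndTensor d
    (Pi.lift (fun k => Ind.yoneda.map (weightedSumProj B' n k) ≫ b' k))) key
  simpa only [Functor.map_comp, Category.assoc, map_comp_toIndTensor,
    map_app_comp_toIndTensor, hq, hb] using h3

lemma preservesLimitsOfShape_of_isMetrizable [HasCountableProducts (Ind (BanMod R))]
    (hV : V.IsMetrizable) (K : Type) [Countable K] :
    PreservesLimitsOfShape (Discrete K) ((indTensor R).obj V) := by
  have (W : K → Ind (BanMod R)) : PreservesLimit (Discrete.functor W) ((indTensor R).obj V) := by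
    have : IsIso (piComparison ((indTensor R).obj V) W) := by
      refine isIso_of_bijective _ fun X => ⟨fun x x' h => ?_, fun y => ?_⟩
      · refine indTensor_pi_ext hV W fun k => ?_
        have h1 : (x ≫ piComparison ((indTensor R).obj V) W) ≫ Pi.π _ k =
            (x' ≫ piComparison ((indTensor R).obj V) W) ≫ Pi.π _ k := congrArg (· ≫ Pi.π _ k) h
        simpa only [Category.assoc, piComparison_comp_π] using h1
      · obtain ⟨x, hx⟩ := exists_indTensor_lift hV W fun k => y ≫ Pi.π _ k
        refine ⟨x, Pi.hom_ext _ _ fun k => ?_⟩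
        exact (Category.assoc _ _ _).trans ((congrArg (x ≫ ·) (piComparison_comp_π _ _ _)).trans
          (hx k))
    exact PreservesProduct.of_iso_comparison _ _
  exact preservesLimitsOfShape_of_discrete _

section TensorProdToProd

variable [HasCountableProducts (Ind (BanMod R))]

/-- The `n`-th component of an element of `V ⊗̂ ∏_ℤ R`. -/
lemma toIndTensor_comp_tensorProdToProd {A B : BanMod R} (a : Ind.yoneda.obj A ⟶ V)
    (b : Ind.yoneda.obj B ⟶ ∏ᶜ fun _ : ℤ => indUnit R) (n : ℤ) (g : B ⟶ self R)
    (hg : Ind.yoneda.map g = b ≫ Pi.π (fun _ : ℤ => indUnit R) n) :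
    toIndTensor a b ≫ tensorProdToProd V ≫ Pi.π (fun _ : ℤ => V) n =
      Ind.yoneda.map (((tensorFunctor R).obj A).map g ≫ (tensorUnitIso R).hom.app A) ≫ a := by
  rw [tensorProdToProd, Pi.lift_π, ← Category.assoc, toIndTensor_comp_map, ← hg]
  exact toExtendBifunctor_comp_extendUnit (tensorUnitIso R) a g

lemma isIso_tensorProdToProd [PreservesLimitsOfShape (Discrete ℤ) ((indTensor R).obj V)] :
    IsIso (tensorProdToProd V) := by
  have : IsIso (indTensorUnit V) := isIso_extendUnit (tensorUnitIso R) V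
  have h : tensorProdToProd V = piComparison ((indTensor R).obj V) (fun _ : ℤ => indUnit R) ≫
      Limits.Pi.map (fun _ : ℤ => indTensorUnit V) := Pi.hom_ext _ _ fun n => by
    simp [tensorProdToProd]
  rw [h]
  infer_instance

/-- Surjectivity of `V ⊗̂ ∏_ℤ R ⟶ ∏_ℤ V` gives common upper bounds of countably many objects over
`V`, and injectivity equalizes countably many parallel morphisms. -/
lemma isMetrizable_of_isIso_tensorProdToProd [IsIso (tensorProdToProd V)] :
    V.IsMetrizable := by
  have hcomp : ∀ {B : BanMod R} (b : Ind.yoneda.obj B ⟶ ∏ᶜ fun _ : ℤ => indUnit R) (n : ℤ),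
      ∃ g : B ⟶ self R, Ind.yoneda.map g = b ≫ Pi.π (fun _ : ℤ => indUnit R) n :=
    fun b n => Ind.yoneda.map_surjective _
  refine isMetrizable_of_int (fun A a => ?_) (fun X Y b f f' hf => ?_)
  -- the family `a` is recovered from the morphism `x` by composing with the inclusions of the `A n`
  · let x : Ind.yoneda.obj (weightedSum A 0) ⟶ ∏ᶜ fun _ : ℤ => V :=
      Pi.lift fun n => Ind.yoneda.map (weightedSumProj A 0 n) ≫ a n
    obtain ⟨D, B, d, b, ξ, hξ⟩ :=
      exists_comp_toIndTensor_eq (x ≫ inv (tensorProdToProd V))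
    choose g hg using hcomp b
    refine ⟨D, d, fun n => weightedSumIncl A 0 n ≫ ξ ≫ ((tensorFunctor R).obj D).map (g n) ≫
      (tensorUnitIso R).hom.app D, fun n => ?_⟩
    have h1 := toIndTensor_comp_tensorProdToProd d b n (g n) (hg n)
    rw [Functor.map_comp, Functor.map_comp, Category.assoc, Category.assoc, ← h1,
      reassoc_of% hξ]
    rw [IsIso.inv_hom_id_assoc, Pi.lift_π, ← Functor.map_comp_assoc,
      weightedSumIncl_comp_weightedSumProj, CategoryTheory.Functor.map_id, Category.id_comp]
  -- `ξ` and `ξ'` represent the families `(f n)` and `(f')` in `Y ⊗̂ ∏_ℤ R`, with common weights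
  · let u := (tensorUnitIso R).inv.app Y
    obtain ⟨n₁, h₁⟩ := exists_tensor_weightedSum_lift (fun _ : ℤ => self R) fun n => f n ≫ u
    obtain ⟨n₂, h₂⟩ := exists_tensor_weightedSum_lift (fun _ : ℤ => self R) fun n => f' ≫ u
    obtain ⟨ξ, hξ⟩ := h₁ (n₁ ⊔ n₂) le_sup_left
    obtain ⟨ξ', hξ'⟩ := h₂ (n₁ ⊔ n₂) le_sup_right
    let B := weightedSum (fun _ : ℤ => self R) (n₁ ⊔ n₂)
    let p (n : ℤ) : B ⟶ self R := weightedSumProj (fun _ : ℤ => self R) (n₁ ⊔ n₂) n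
    let φ (n : ℤ) : Ind.yoneda.obj B ⟶ indUnit R := Ind.yoneda.map (p n)
    obtain ⟨c, hc⟩ : ∃ c : Ind.yoneda.obj B ⟶ ∏ᶜ fun _ : ℤ => indUnit R,
        ∀ n, φ n = c ≫ Pi.π (fun _ : ℤ => indUnit R) n :=
      ⟨Pi.lift φ, fun n => by rw [Pi.lift_π]⟩
    have key : Ind.yoneda.map ξ ≫ toIndTensor b c = Ind.yoneda.map ξ' ≫ toIndTensor b c := by
      rw [← cancel_mono (tensorProdToProd V)]
      refine Pi.hom_ext _ _ fun n => ?_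
      have h3 := toIndTensor_comp_tensorProdToProd b c n (p n) (hc n)
      have h4 : ξ ≫ ((tensorFunctor R).obj Y).map (p n) ≫ (tensorUnitIso R).hom.app Y = f n := by
        rw [reassoc_of% (hξ n)]
        simp [u]
      have h5 : ξ' ≫ ((tensorFunctor R).obj Y).map (p n) ≫ (tensorUnitIso R).hom.app Y = f' := by
        rw [reassoc_of% (hξ' n)]
        simp [u]
      rw [Category.assoc, Category.assoc, Category.assoc, Category.assoc, h3,
        ← Functor.map_comp_assoc, ← Functor.map_comp_assoc, h4, h5, hf]
    obtain ⟨D, B', d, c', g, r, hg, hr, h⟩ := exists_comp_map_eq_of_toIndTensor b c key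
    refine ⟨D, d, g, hg, fun n => ?_⟩
    obtain ⟨q, hq⟩ := hcomp c' n
    have hrq : r ≫ q = p n := Ind.yoneda.map_injective (by
      rw [Functor.map_comp, hq]
      exact (Category.assoc _ _ _).symm.trans ((congrArg (· ≫ Pi.π _ n) hr).trans (hc n).symm))
    have h3 : ((tensorFunctor R).map g).app B ≫ ((tensorFunctor R).obj D).map r ≫
        ((tensorFunctor R).obj D).map q ≫ (tensorUnitIso R).hom.app D =
        ((tensorFunctor R).obj Y).map (p n) ≫ (tensorUnitIso R).hom.app Y ≫ g := by
      rw [← Functor.map_comp_assoc, hrq, ← NatTrans.naturality_assoc]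
      exact congrArg (_ ≫ ·) ((tensorUnitIso R).hom.naturality g)
    have h4 := congrArg
      (· ≫ ((tensorFunctor R).obj D).map q ≫ (tensorUnitIso R).hom.app D) h
    simp only [Category.assoc, h3] at h4
    rw [reassoc_of% (hξ n), reassoc_of% (hξ' n)] at h4
    simpa [u] using h4

end TensorProdToProd

end

theorem mainTheorem3 (R : Type u) [BanachRing R] :
    ∃ _ : HasCountableProducts (Ind (BanMod R)), ∀ V : Ind (BanMod R),
      (V.IsMetrizable ↔ ∀ (K : Type) [Countable K],
        PreservesLimitsOfShape (Discrete K) ((indTensor R).obj V)) ∧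
      (IsIso (tensorProdToProd V) → V.IsMetrizable) := by
  refine ⟨BanMod.hasCountableProducts_ind R, fun V => ?_⟩
  have := BanMod.hasCountableProducts_ind R
  refine ⟨⟨fun hV K _ => preservesLimitsOfShape_of_isMetrizable hV K, fun h => ?_⟩,
    fun _ => isMetrizable_of_isIso_tensorProdToProd⟩
  have := h ℤ
  have := isIso_tensorProdToProd (V := V)
  exact isMetrizable_of_isIso_tensorProdToProd
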